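/- **Conventions.** $\mathrm{Cat}$ is the category of small categories and functors, $e$ is the terminal category, and $A/a$ is the slice category over an object $a$. For $w\colon A\to C$ and an object $c$ of $C$, $A/c$ denotes the category of pairs $(a,\ w(a)\to c)$. A class $\mathcal W$ of functors between small categories is a *basic localizer* if: 1. it is weakly saturated: it contains all isomorphisms, satisfies 2-out-of-3, and whenever $i\colon X\to Y$, $r\colon Y\to X$ satisfy $ri=\mathrm{id}_X$ and $ir\in\mathcal W$, then $r\in\mathcal W$; 2. $A\to e$ is in $\mathcal W$ for every small category $A$ with a terminal object; 3. for every commutative triangle formed by $u\colon A\to B$, $v\colon B\to C$ and $vu\colon A\to C$ in $\mathrm{Cat}$, if the induced functor $A/c\to B/c$ is in $\mathcal W$ for every object $c$ of $C$, then $u\in\mathcal W$. An adjunction $L\dashv R$ between categories equipped with classes of weak equivalences is a *homotopical equivalence* if $L$ and $R$ preserve weak equivalences and the unit and counit are pointwise weak equivalences. Let $A$ be a small category. Let $i_A\colon [A^{op},\mathrm{Set}]\to\mathrm{Cat}$ send $X$ to its category of elements, with right adjoint $i_A^*(C)=\bigl(a\mapsto \mathrm{Hom}_{\mathrm{Cat}}(A/a,C)\bigr)$.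 Let $I_A\colon[A^{op},\mathrm{Grpd}]\to\mathrm{Cat}$ (strict presheaves of small groupoids, strict natural transformations) send $X$ to the category whose objects are the pairs $(a,x)$ with $x\in \mathrm{Ob}\,X(a)$ and whose morphisms $(a,x)\to(a',x')$ are the pairs $(f\colon a\to a',\ k\colon x\to X(f)(x'))$; its right adjoint is $I_A^*(C)=\bigl(a\mapsto \underline{\mathrm{Iso}}(A/a,C)\bigr)$, where $\underline{\mathrm{Iso}}(D,C)$ is the groupoid of functors $D\to C$ and natural isomorphisms between them. Given a basic localizer $\mathcal W$, the weak equivalences are $\mathcal W$ on $\mathrm{Cat}$, $i_A^{-1}(\mathcal W)$ on $[A^{op},\mathrm{Set}]$ and $I_A^{-1}(\mathcal W)$ on $[A^{op},\mathrm{Grpd}]$. The category $A$ is a *weak test category* (resp. a *groupoidal weak test category*), relative to $\mathcal W$, if $i_A\dashv i_A^*$ (resp. $I_A\dashv I_A^*$) is a homotopical equivalence. **Theorem.** Let $\mathcal W$ be a basic localizer and let $A$ be a small category. If $A$ is a weak test category, then $A$ is a groupoidal weak test category. If moreover $A$ has no non-trivial isomorphisms (every isomorphism of $A$ is an identity), then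 conversely, if $A$ is a groupoidal weak test category, then $A$ is a weak test category. -/

import Mathlib

open CategoryTheory Opposite

universe u v w

namespace TestCat

/-- A class of morphisms is *weakly saturated* if it contains the isomorphisms, has the 2-out-of-3
property, and contains every retraction `r` (with section `i`) such that `r ≫ i` is in the class. -/
structure IsWeaklySaturated {C : Type v} [Category.{w} C] (W : MorphismProperty C) : Prop where
  isomorphisms_le : MorphismProperty.isomorphisms C ≤ W
  twoOutOfThree : W.HasTwoOutOfThreeProperty
  of_retraction : ∀ {X Y : C} (i : X ⟶ Y) (r : Y ⟶ X), i ≫ r = 𝟙 X → W (r ≫ i) → W r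

/-- A *basic localizer* of the category of small categories. The comma category
`CostructuredArrow v c` is the slice `B/c` relative to `v : B ⥤ C`, and `CostructuredArrow.pre u v c`
is the functor `A/c ⥤ B/c` induced by `u : A ⥤ B`. -/
structure IsBasicLocalizer (W : MorphismProperty Cat.{u, u}) : Prop where
  weaklySaturated : IsWeaklySaturated W
  of_hasTerminal : ∀ (A : Type u) [SmallCategory A] [Limits.HasTerminal A],
    W (Functor.toCatHom (Functor.star A : A ⥤ Discrete PUnit.{u + 1}))
  of_slices : ∀ {A B C : Type u} [SmallCategory A] [SmallCategory B] [SmallCategory C]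
    (u : A ⥤ B) (v : B ⥤ C),
    (∀ c : C, W (CostructuredArrow.pre u v c).toCatHom) → W u.toCatHom

/-- An adjunction is a *homotopical equivalence* if both adjoints preserve weak equivalences and
the unit and the counit are pointwise weak equivalences. -/
structure IsHomotopicalEquivalence {C : Type*} {D : Type*} [Category* C] [Category* D]
    (W : MorphismProperty C) (W' : MorphismProperty D) {L : C ⥤ D} {R : D ⥤ C} (adj : L ⊣ R) :
    Prop where
  map_left : ∀ {X Y : C} (f : X ⟶ Y), W f → W' (L.map f)
  map_right : ∀ {X Y : D} (f : X ⟶ Y), W' f → W (R.map f)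
  counit : ∀ X : D, W' (adj.counit.app X)
  unit : ∀ Y : C, W (adj.unit.app Y)

/-- `A` has no non-trivial isomorphisms: every isomorphism of `A` is an identity. -/
def HasNoNontrivialIso (A : Type v) [Category.{w} A] : Prop :=
  MorphismProperty.isomorphisms A ≤ MorphismProperty.identities A

variable {A : Type u} [SmallCategory A]

/-- Objects `(a, x)`, `x ∈ X(a)`, of the category of elements `A/X`. -/
structure El (X : Aᵒᵖ ⥤ Type u) : Type u where
  base : A
  pt : X.obj (op base)

/-- Morphisms `(a, x) ⟶ (a', x')` of `A/X`: morphisms `f : a ⟶ a'` such that `x = X(f)(x')`. -/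
@[ext]
structure El.Hom {X : Aᵒᵖ ⥤ Type u} (p q : El X) : Type u where
  hom : p.base ⟶ q.base
  w : X.map hom.op q.pt = p.pt

instance (X : Aᵒᵖ ⥤ Type u) : SmallCategory (El X) where
  Hom p q := El.Hom p q
  id p := ⟨𝟙 _, by simp⟩
  comp f g := ⟨f.hom ≫ g.hom, by simp [g.w, f.w]⟩

namespace El

variable {X Y : Aᵒᵖ ⥤ Type u}

@[ext] lemma hom_ext {p q : El X} {f g : p ⟶ q} (h : f.hom = g.hom) : f = g := El.Hom.ext h

@[simp] lemma id_hom (p : El X) : Hom.hom (𝟙 p) = 𝟙 p.base := rfl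

@[simp] lemma comp_hom {p q r : El X} (f : p ⟶ q) (g : q ⟶ r) :
    Hom.hom (f ≫ g) = f.hom ≫ g.hom := rfl

lemma hom_heq {p q p' q' : El X} (hp : p = p') (hq : q = q') {f : p ⟶ q} {g : p' ⟶ q'}
    (h : f.hom ≍ g.hom) : f ≍ g := by
  subst hp
  subst hq
  exact heq_of_eq (hom_ext (eq_of_heq h))

/-- The functor `A/X ⥤ A/Y` induced by `φ : X ⟶ Y`. -/
@[simps]
def map (φ : X ⟶ Y) : El X ⥤ El Y where
  obj p := ⟨p.base, φ.app _ p.pt⟩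
  map {p q} f := ⟨f.hom, by rw [← f.w]; exact (φ.naturality_apply f.hom.op q.pt).symm⟩

/-- The functor `A/a ⥤ A/X` sending `p : b ⟶ a` to `(b, X(p)(x))`, for `x ∈ X(a)`. -/
@[simps]
def fromOver {a : A} (x : X.obj (op a)) : Over a ⥤ El X where
  obj p := ⟨p.left, X.map p.hom.op x⟩
  map {p q} f := ⟨f.left, by
    have h := Over.w f
    rw [← Functor.map_comp_apply, ← op_comp, h]⟩

end El

/-- `i_A : Psh(A) ⥤ Cat`, `X ↦ A/X`. -/
@[simps]
def elFunctor (A : Type u) [SmallCategory A] : (Aᵒᵖ ⥤ Type u) ⥤ Cat.{u, u} where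
  obj X := Cat.of (El X)
  map φ := (El.map φ).toCatHom

/-- For `i : A ⥤ Cat`, the functor `i^* : Cat ⥤ Psh(A)`, `C ↦ (a ↦ Hom_Cat(i(a), C))`. -/
@[simps!]
def nerve (i : A ⥤ Cat.{u, u}) : Cat.{u, u} ⥤ (Aᵒᵖ ⥤ Type u) :=
  yoneda ⋙ (Functor.whiskeringLeft _ _ _).obj i.op

/-- `i_A^* : Cat ⥤ Psh(A)`, `C ↦ (a ↦ Hom_Cat(A/a, C))`. -/
abbrev elNerve (A : Type u) [SmallCategory A] : Cat.{u, u} ⥤ (Aᵒᵖ ⥤ Type u) :=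
  nerve (Over.mapFunctor A)

/-- The morphism `f : (b, f) ⟶ (a, 𝟙)` of `A/a`, for `f : b ⟶ a`; its source is written as the image
of `(b, 𝟙)` under `A/b ⥤ A/a`. -/
def toId {b a : A} (f : b ⟶ a) : (Over.map f).obj (Over.mk (𝟙 b)) ⟶ Over.mk (𝟙 a) :=
  Over.homMk f (by simp)

@[simp] lemma toId_left {b a : A} (f : b ⟶ a) : (toId f).left = f := rfl

lemma eqToHom_app_comp_heq {D : Type*} {E : Type*} [Category* D] [Category* E] {F G : D ⥤ E}
    (h : F = G) (X : D) {Z : E} (g : G.obj X ⟶ Z) : (eqToHom h).app X ≫ g ≍ g := by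
  subst h
  simp

lemma functor_map_heq {D : Type*} {E : Type*} [Category* D] [Category* E] (F : D ⥤ E)
    {X Y X' Y' : D} (hX : X = X') (hY : Y = Y') {f : X ⟶ Y} {g : X' ⟶ Y'} (h : f ≍ g) :
    F.map f ≍ F.map g := by
  subst hX
  subst hY
  rw [eq_of_heq h]

lemma functor_map_comp_eqToHom_heq {D : Type*} {E : Type*} [Category* D] [Category* E]
    (F : D ⥤ E) {x y z : D} (k : x ⟶ y) (h : y = z) : F.map (k ≫ eqToHom h) ≍ F.map k := by
  subst h
  simp

lemma comp_map_eqToHom_comp_heq {D : Type*} {E : Type*} [Category* D] [Category* E]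
    (F : D ⥤ E) {x y : E} {z w : D} {t : E} (k : x ⟶ y) (h₁ : z = w) (h₂ : y = F.obj z)
    (h₃ : F.obj w = t) : (k ≫ eqToHom h₂) ≫ F.map (eqToHom h₁) ≫ eqToHom h₃ ≍ k := by
  subst h₁
  subst h₂
  subst h₃
  simp

lemma map_id_comp_eqToHom {D : Type*} {E : Type*} [Category* D] [Category* E]
    (F : D ⥤ E) {x : D} {y : E} (h : F.obj x = y) : F.map (𝟙 x) ≫ eqToHom h = eqToHom h := by
  simp

lemma map_comp_heq {D : Type*} {E : Type*} [Category* D] [Category* E] (F : D ⥤ E) {G : E ⥤ E}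
    (hG : G = 𝟭 E) {x y z : D} {s r : E} (k : x ⟶ y) (l : y ⟶ z) (h₁ : F.obj y = G.obj (F.obj y))
    (h₂ : F.obj z = s) (h₃ : G.obj s = r) :
    (F.map k ≫ eqToHom h₁) ≫ G.map (F.map l ≫ eqToHom h₂) ≫ eqToHom h₃ ≍ F.map (k ≫ l) := by
  subst hG
  subst h₂
  subst h₃
  simp

lemma comp_map_id_comp_heq {D : Type*} {E : Type*} [Category* D] [Category* E] (F : D ⥤ E)
    {x : D} {y z t : E} (k : y ⟶ z) (h₁ : z = F.obj x) (h₂ : F.obj x = t) :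
    (k ≫ eqToHom h₁) ≫ F.map (𝟙 x) ≫ eqToHom h₂ ≍ k := by
  subst h₁
  subst h₂
  simp

lemma comp_eqToHom_comp_heq {D : Type*} [Category* D] {x y z w : D} (k : x ⟶ y) (h : y = z)
    (m : z ⟶ w) (hw : z = w) (hm : m ≍ 𝟙 w) : k ≫ eqToHom h ≫ m ≍ k := by
  subst hw
  subst h
  rw [eq_of_heq hm]
  simp

lemma natTrans_app_heq {D : Type*} {E : Type*} [Category* D] [Category* E] {F G : D ⥤ E}
    (α : F ⟶ G) {X Y : D} (h : X = Y) : α.app X ≍ α.app Y := by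
  subst h
  rfl

lemma eqToHom_heq_eqToHom {D : Type*} [Category* D] {x y x' y' : D} (h : x = y) (h' : x' = y')
    (hx : x = x') : eqToHom h ≍ eqToHom h' := by
  subst hx
  subst h
  subst h'
  rfl

lemma core_hom_heq {D : Type*} {E : Type*} [Category* D] [Category* E]
    {P Q P' Q' : Core (D ⥤ E)} (hP : P.of = P'.of) (hQ : Q.of = Q'.of) {k : P ⟶ Q} {l : P' ⟶ Q'}
    (h : ∀ X, k.iso.hom.app X ≍ l.iso.hom.app X) : k ≍ l := by
  obtain ⟨P⟩ := P
  obtain ⟨Q⟩ := Q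
  obtain rfl : P = P'.of := hP
  obtain rfl : Q = Q'.of := hQ
  exact heq_of_eq (Core.hom_ext (NatTrans.ext (funext fun X => eq_of_heq (h X))))

lemma core_eqToHom_app_comp_heq {D : Type*} {E : Type*} [Category* D] [Category* E]
    {P Q : Core (D ⥤ E)} (h : P = Q) (X : D) {Z : E} (m : Q.of.obj X ⟶ Z) :
    (CoreHom.iso (eqToHom h)).hom.app X ≫ m ≍ m := by
  subst h
  change 𝟙 _ ≫ m ≍ m
  simp

lemma core_comp_eqToHom_app_comp {D : Type*} {E : Type*} [Category* D] [Category* E]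
    {P Q R : Core (D ⥤ E)} (k : P ⟶ Q) (h : Q = R) (X : D) {Z : E} (m : R.of.obj X ⟶ Z) :
    (CoreHom.iso (k ≫ eqToHom h)).hom.app X ≫ m =
      k.iso.hom.app X ≫ eqToHom (by rw [h]) ≫ m := by
  subst h
  simp

lemma core_eqToHom_app_comp {D : Type*} {E : Type*} [Category* D] [Category* E]
    {F G : D ⥤ E} (h : Core.mk F = Core.mk G) (X : D) {Z : E} (m : G.obj X ⟶ Z) :
    (CoreHom.iso (eqToHom h)).hom.app X ≫ m =
      eqToHom (congrArg (fun P : Core (D ⥤ E) => P.of.obj X) h) ≫ m := by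
  obtain rfl : F = G := congrArg Core.of h
  rfl

lemma over_hom_heq {a : A} {p q p' q' : Over a} (hp : p = p') (hq : q = q') {f : p ⟶ q}
    {g : p' ⟶ q'} (h : f.left ≍ g.left) : f ≍ g := by
  subst hp
  subst hq
  exact heq_of_eq (Over.OverMorphism.ext (eq_of_heq h))

lemma over_map_id_mk {b a : A} (f : b ⟶ a) :
    (Over.map f).obj (Over.mk (𝟙 b)) = Over.mk f := by
  change Over.mk (𝟙 b ≫ f) = Over.mk f
  rw [Category.id_comp]

lemma toId_id_heq (a : A) : toId (𝟙 a) ≍ 𝟙 (Over.mk (𝟙 a)) :=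
  over_hom_heq (over_map_id_mk (𝟙 a)) rfl HEq.rfl

lemma map_toId_id_heq {a : A} {D : Type*} [Category* D] (P : Over a ⥤ D) :
    P.map (toId (𝟙 a)) ≍ 𝟙 (P.obj (Over.mk (𝟙 a))) :=
  (functor_map_heq P (over_map_id_mk (𝟙 a)) rfl (toId_id_heq a)).trans
    (heq_of_eq (P.map_id _))

lemma toId_comp {a b c : A} (f : a ⟶ b) (g : b ⟶ c) :
    toId (f ≫ g) = eqToHom ((over_map_id_mk _).trans
      ((congrArg (Over.map g).obj (over_map_id_mk f)).trans (by rfl)).symm) ≫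
      (Over.map g).map (toId f) ≫ toId g := by
  ext
  simp only [Over.comp_left, Over.eqToHom_left]
  simp

lemma map_toId_comp {a b c : A} (f : a ⟶ b) (g : b ⟶ c) {D : Type*} [Category* D]
    {P : Over a ⥤ D} {Q : Over b ⥤ D} {R : Over c ⥤ D} (hP : P = Over.map f ⋙ Q)
    (hQ : Q = Over.map g ⋙ R) (hPR : P = Over.map (f ≫ g) ⋙ R) :
    (eqToHom hPR).app (Over.mk (𝟙 a)) ≫ R.map (toId (f ≫ g)) =
      ((eqToHom hP).app (Over.mk (𝟙 a)) ≫ Q.map (toId f)) ≫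
        (eqToHom hQ).app (Over.mk (𝟙 b)) ≫ R.map (toId g) := by
  subst hQ
  subst hP
  rw [toId_comp, R.map_comp, R.map_comp, eqToHom_map, eqToHom_app, eqToHom_trans_assoc]
  simp

lemma El.w_toFunctor {C : Cat.{u, u}} {p q : El ((elNerve A).obj C)} (f : p ⟶ q) :
    p.pt.toFunctor = Over.map f.hom ⋙ q.pt.toFunctor :=
  congrArg Cat.Hom.toFunctor f.w.symm

/-- The component at `C` of the counit of `i_A ⊣ i_A^*`: it sends `(a, p : A/a ⥤ C)` to the value
of `p` at the terminal object `𝟙 a` of `A/a`. -/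
@[simps]
def elCounitFunctor (C : Cat.{u, u}) : El ((elNerve A).obj C) ⥤ C where
  obj p := p.pt.toFunctor.obj (Over.mk (𝟙 p.base))
  map {p q} f := (eqToHom (El.w_toFunctor f)).app (Over.mk (𝟙 p.base)) ≫
    q.pt.toFunctor.map (toId f.hom)
  map_id p := by
    exact eq_of_heq ((eqToHom_app_comp_heq _ _ _).trans (map_toId_id_heq _))
  map_comp {p q r} f g := by
    exact map_toId_comp _ _ _ _ _

lemma El.fromOver_map (X : Aᵒᵖ ⥤ Type u) {a b : A} (f : b ⟶ a) (x : X.obj (op a)) :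
    El.fromOver (X.map f.op x) = Over.map f ⋙ El.fromOver x := by
  have h (p : Over b) : (El.fromOver (X.map f.op x)).obj p = (Over.map f ⋙ El.fromOver x).obj p :=
    congrArg (El.mk p.left) (by simp)
  exact CategoryTheory.Functor.hext h (fun p q g => El.hom_heq (h p) (h q) HEq.rfl)

lemma El.fromOver_comp_map {X Y : Aᵒᵖ ⥤ Type u} (φ : X ⟶ Y) {a : A} (x : X.obj (op a)) :
    El.fromOver (φ.app _ x) = El.fromOver x ⋙ El.map φ := by
  have h (p : Over a) : (El.fromOver (φ.app _ x)).obj p = (El.fromOver x ⋙ El.map φ).obj p :=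
    congrArg (El.mk p.left) (φ.naturality_apply p.hom.op x).symm
  exact CategoryTheory.Functor.hext h (fun p q g => El.hom_heq (h p) (h q) HEq.rfl)

lemma elCounitFunctor_naturality {C D : Cat.{u, u}} (F : C ⟶ D) :
    El.map ((elNerve A).map F) ⋙ elCounitFunctor D = elCounitFunctor C ⋙ F.toFunctor := by
  refine CategoryTheory.Functor.hext (fun p => rfl) (fun p q g => ?_)
  refine (eqToHom_app_comp_heq _ _ _).trans (HEq.symm ?_)
  exact functor_map_heq F.toFunctor (Functor.congr_obj (El.w_toFunctor g) _) rfl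
    (eqToHom_app_comp_heq _ _ _)

lemma over_map_map_toId_heq {a : A} {q r : Over a} (g : q ⟶ r) :
    (Over.map r.hom).map (toId g.left) ≍ g := by
  refine over_hom_heq ?_ (over_map_id_mk r.hom) HEq.rfl
  rw [over_map_id_mk]
  exact congrArg Over.mk (Over.w g)

lemma over_map_map_toId_obj {a : A} {q r : Over a} (g : q ⟶ r) :
    (Over.map r.hom).obj ((Over.map g.left).obj (Over.mk (𝟙 q.left))) = q := by
  rw [over_map_id_mk]
  exact congrArg Over.mk (Over.w g)

lemma fromOver_comp_elCounitFunctor {C : Cat.{u, u}} {a : A} (p : Over a ⥤ C) :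
    El.fromOver (X := (elNerve A).obj C) (a := a) p.toCatHom ⋙ elCounitFunctor C = p := by
  refine CategoryTheory.Functor.hext (fun q => congrArg p.obj (over_map_id_mk q.hom))
    (fun q r g => ?_)
  refine (eqToHom_app_comp_heq _ _ _).trans ?_
  exact functor_map_heq p (over_map_map_toId_obj g) (over_map_id_mk r.hom)
    (over_map_map_toId_heq g)

/-- The unit of `i_A ⊣ i_A^*`: it sends `x ∈ X(a)` to `A/a ⥤ A/X`, `p ↦ X(p)(x)`. -/
def elUnit : 𝟭 (Aᵒᵖ ⥤ Type u) ⟶ elFunctor A ⋙ elNerve A where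
  app X :=
    { app a := ↾(fun x => (El.fromOver (a := a.unop) x).toCatHom)
      naturality a b f := by
        ext x
        exact Cat.ext (El.fromOver_map X f.unop x) }
  naturality X Y φ := by
    ext a x
    exact Cat.ext (El.fromOver_comp_map φ x)

lemma elMap_elUnit_comp (X : Aᵒᵖ ⥤ Type u) :
    El.map (elUnit.app X) ⋙ elCounitFunctor (Cat.of (El X)) = 𝟭 (El X) := by
  have h (p : El X) : (El.map (elUnit.app X) ⋙ elCounitFunctor (Cat.of (El X))).obj p = p :=
    congrArg (El.mk p.base) (by
      change X.map (𝟙 _) p.pt = p.pt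
      simp)
  refine CategoryTheory.Functor.hext h (fun p q g => (eqToHom_app_comp_heq _ _ _).trans ?_)
  refine El.hom_heq ?_ (h q) HEq.rfl
  refine congrArg (El.mk p.base) ?_
  change X.map (𝟙 _ ≫ g.hom).op q.pt = p.pt
  rw [Category.id_comp]
  exact g.w

/-- The counit of `i_A ⊣ i_A^*`. -/
def elCounit : elNerve A ⋙ elFunctor A ⟶ 𝟭 Cat.{u, u} where
  app C := (elCounitFunctor C).toCatHom
  naturality _ _ F := Cat.ext (elCounitFunctor_naturality F)

/-- The adjunction `i_A ⊣ i_A^*`. -/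
def elAdjunction (A : Type u) [SmallCategory A] : elFunctor A ⊣ elNerve A where
  unit := elUnit
  counit := elCounit
  left_triangle_components X := Cat.ext (elMap_elUnit_comp X)
  right_triangle_components C := by
    ext a p
    exact Cat.ext (fromOver_comp_elCounitFunctor p.toFunctor)

/-- The restriction functor `X(f) : X(b) ⥤ X(a)` along `f : a ⟶ b`. -/
def res (X : Aᵒᵖ ⥤ Grpd.{u, u}) {a b : A} (f : a ⟶ b) : X.obj (op b) ⥤ X.obj (op a) :=
  X.map f.op

lemma res_id (X : Aᵒᵖ ⥤ Grpd.{u, u}) (a : A) : res X (𝟙 a) = 𝟭 _ := X.map_id (op a)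

lemma res_comp (X : Aᵒᵖ ⥤ Grpd.{u, u}) {a b c : A} (f : a ⟶ b) (g : b ⟶ c) :
    res X (f ≫ g) = res X g ⋙ res X f := X.map_comp g.op f.op

/-- The component `X(a) ⥤ Y(a)` of a morphism of presheaves of groupoids. -/
def compAt {X Y : Aᵒᵖ ⥤ Grpd.{u, u}} (φ : X ⟶ Y) (a : A) : X.obj (op a) ⥤ Y.obj (op a) :=
  φ.app (op a)

lemma res_comp_comp {X Y : Aᵒᵖ ⥤ Grpd.{u, u}} (φ : X ⟶ Y) {a b : A} (f : a ⟶ b) :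
    res X f ⋙ compAt φ a = compAt φ b ⋙ res Y f := φ.naturality f.op

/-- Objects `(a, x)`, `x` an object of `X(a)`, of the category of elements `A//X`. -/
structure GEl (X : Aᵒᵖ ⥤ Grpd.{u, u}) : Type u where
  base : A
  pt : X.obj (op base)

/-- Morphisms `(a, x) ⟶ (a', x')` of `A//X`: pairs of `f : a ⟶ a'` and `k : x ⟶ X(f)(x')`. -/
structure GEl.Hom {X : Aᵒᵖ ⥤ Grpd.{u, u}} (p q : GEl X) : Type u where
  hom : p.base ⟶ q.base
  fiber : p.pt ⟶ (res X hom).obj q.pt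

namespace GEl

variable {X Y Z : Aᵒᵖ ⥤ Grpd.{u, u}}

lemma res_id_obj (X : Aᵒᵖ ⥤ Grpd.{u, u}) {a : A} (x : X.obj (op a)) :
    (res X (𝟙 a)).obj x = x :=
  Functor.congr_obj (res_id X a) x

lemma res_comp_obj (X : Aᵒᵖ ⥤ Grpd.{u, u}) {a b c : A} (f : a ⟶ b) (g : b ⟶ c)
    (x : X.obj (op c)) : (res X (f ≫ g)).obj x = (res X f).obj ((res X g).obj x) :=
  Functor.congr_obj (res_comp X f g) x

lemma Hom.ext_heq {p q : GEl X} {f g : GEl.Hom p q} (h : f.hom = g.hom)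
    (h' : f.fiber ≍ g.fiber) : f = g := by
  obtain ⟨f, k⟩ := f
  obtain ⟨g, l⟩ := g
  obtain rfl : f = g := h
  obtain rfl : k = l := eq_of_heq h'
  rfl

instance (X : Aᵒᵖ ⥤ Grpd.{u, u}) : SmallCategory (GEl X) where
  Hom p q := GEl.Hom p q
  id p := ⟨𝟙 _, eqToHom (res_id_obj X p.pt).symm⟩
  comp {p q r} f g := ⟨f.hom ≫ g.hom, f.fiber ≫ (res X f.hom).map g.fiber ≫
    eqToHom (res_comp_obj X f.hom g.hom r.pt).symm⟩
  id_comp {p q} f := by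
    refine Hom.ext_heq (Category.id_comp _) ?_
    dsimp only
    rw [Functor.congr_hom (res_id X p.base) f.fiber]
    simp
  comp_id {p q} f := by
    refine Hom.ext_heq (Category.comp_id _) ?_
    dsimp only
    simp [eqToHom_map]
  assoc {p q r s} f g h := by
    refine Hom.ext_heq (Category.assoc _ _ _) ?_
    dsimp only
    rw [Functor.congr_hom (res_comp X f.hom g.hom) h.fiber]
    simp only [Functor.map_comp, eqToHom_map, Category.assoc, eqToHom_trans, Functor.comp_map,
      eqToHom_trans_assoc, eqToHom_refl, Category.id_comp]
    simp only [← Category.assoc]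
    exact (comp_eqToHom_heq _ _).trans (comp_eqToHom_heq _ _).symm

lemma hom_ext {p q : GEl X} {f g : p ⟶ q} (h : f.hom = g.hom) (h' : f.fiber ≍ g.fiber) :
    f = g := Hom.ext_heq h h'

lemma hom_heq {p q p' q' : GEl X} (hp : p = p') (hq : q = q') {f : p ⟶ q} {g : p' ⟶ q'}
    (h : f.hom ≍ g.hom) (h' : f.fiber ≍ g.fiber) : f ≍ g := by
  subst hp
  subst hq
  exact heq_of_eq (hom_ext (eq_of_heq h) h')

@[simp] lemma id_hom (p : GEl X) : Hom.hom (𝟙 p) = 𝟙 p.base := rfl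

@[simp] lemma id_fiber (p : GEl X) : Hom.fiber (𝟙 p) = eqToHom (res_id_obj X p.pt).symm := rfl

@[simp] lemma comp_hom {p q r : GEl X} (f : p ⟶ q) (g : q ⟶ r) :
    Hom.hom (f ≫ g) = f.hom ≫ g.hom := rfl

@[simp] lemma comp_fiber {p q r : GEl X} (f : p ⟶ q) (g : q ⟶ r) :
    Hom.fiber (f ≫ g) = f.fiber ≫ (res X f.hom).map g.fiber ≫
      eqToHom (res_comp_obj X f.hom g.hom r.pt).symm := rfl

/-- The functor `A//X ⥤ A//Y` induced by `φ : X ⟶ Y`. -/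
@[simps]
def map (φ : X ⟶ Y) : GEl X ⥤ GEl Y where
  obj p := ⟨p.base, (compAt φ p.base).obj p.pt⟩
  map {p q} f := ⟨f.hom, (compAt φ p.base).map f.fiber ≫
    eqToHom (Functor.congr_obj (res_comp_comp φ f.hom) q.pt)⟩
  map_id p := by
    refine hom_ext rfl ?_
    simp [eqToHom_map]
  map_comp {p q r} f g := by
    refine hom_ext rfl ?_
    have := Functor.congr_hom (res_comp_comp φ f.hom) g.fiber
    dsimp only [Functor.comp_map] at this
    simp [eqToHom_map, this]

lemma res_over_obj {a : A} (x : X.obj (op a)) {p q : Over a} (f : p ⟶ q) :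
    (res X p.hom).obj x = (res X f.left).obj ((res X q.hom).obj x) := by
  rw [← res_comp_obj, Over.w f]

/-- The functor `A/a ⥤ A//X` sending `p : b ⟶ a` to `(b, X(p)(x))`, for `x` in `X(a)`. -/
@[simps]
def fromOver {a : A} (x : X.obj (op a)) : Over a ⥤ GEl X where
  obj p := ⟨p.left, (res X p.hom).obj x⟩
  map {p q} f := ⟨f.left, eqToHom (res_over_obj x f)⟩
  map_id p := hom_ext rfl (by simp)
  map_comp f g := hom_ext rfl (by simp [eqToHom_map])

/-- The natural transformation `fromOver x ⟶ fromOver y` induced by `k : x ⟶ y` in `X(a)`. -/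
@[simps]
def fromOverMap {a : A} {x y : X.obj (op a)} (k : x ⟶ y) : fromOver x ⟶ fromOver y where
  app p := ⟨𝟙 _, (res X p.hom).map k ≫ eqToHom (res_id_obj X _).symm⟩
  naturality p q f := by
    refine hom_ext ((Category.comp_id f.left).trans (Category.id_comp f.left).symm) ?_
    have h1 := Functor.hcongr_hom
      ((congrArg (res X) (Over.w f)).symm.trans (res_comp X f.left q.hom)) k
    refine (eqToHom_comp_heq _ (res_over_obj x f)).trans ((comp_eqToHom_heq _ _).trans ?_)
    refine (functor_map_comp_eqToHom_heq _ _ _).trans (h1.symm.trans (HEq.symm ?_))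
    exact comp_map_eqToHom_comp_heq (res X (𝟙 p.left)) ((res X p.hom).map k) (res_over_obj y f)
      (res_id_obj X _).symm (res_comp_obj X _ _ _).symm

lemma map_id_eq (X : Aᵒᵖ ⥤ Grpd.{u, u}) : map (𝟙 X) = 𝟭 (GEl X) := by
  refine CategoryTheory.Functor.hext (fun p => rfl) (fun p q g => ?_)
  exact hom_heq rfl rfl HEq.rfl (comp_eqToHom_heq _ _)

lemma map_comp_eq (φ : X ⟶ Y) (ψ : Y ⟶ Z) : map (φ ≫ ψ) = map φ ⋙ map ψ := by
  refine CategoryTheory.Functor.hext (fun p => rfl) (fun p q g => ?_)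
  refine hom_heq rfl rfl HEq.rfl ((comp_eqToHom_heq _ _).trans (HEq.symm ?_))
  refine (comp_eqToHom_heq _ _).trans ?_
  dsimp only [map]
  rw [Functor.map_comp, eqToHom_map]
  exact comp_eqToHom_heq _ _

lemma fromOverMap_id {a : A} (x : X.obj (op a)) : fromOverMap (𝟙 x) = 𝟙 _ := by
  ext p
  exact hom_ext rfl (heq_of_eq (map_id_comp_eqToHom _ _))

lemma fromOverMap_comp {a : A} {x y z : X.obj (op a)} (k : x ⟶ y) (l : y ⟶ z) :
    fromOverMap (k ≫ l) = fromOverMap k ≫ fromOverMap l := by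
  ext p
  refine hom_ext (Category.id_comp _).symm ?_
  refine (comp_eqToHom_heq _ _).trans (HEq.symm ?_)
  exact map_comp_heq (res X p.hom) (res_id X p.left) k l _ _ _

end GEl

/-- `I_A : PshGrpd(A) ⥤ Cat`, `X ↦ A//X`. -/
@[simps]
def gelFunctor (A : Type u) [SmallCategory A] : (Aᵒᵖ ⥤ Grpd.{u, u}) ⥤ Cat.{u, u} where
  obj X := Cat.of (GEl X)
  map φ := (GEl.map φ).toCatHom
  map_id X := Cat.ext (GEl.map_id_eq X)
  map_comp φ ψ := Cat.ext (GEl.map_comp_eq φ ψ)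

/-- For `i : A ⥤ Cat`, the functor `I^*`, sending `C` to the presheaf of groupoids
`a ↦ Homi(i(a), C)` of functors `i(a) ⥤ C` and natural isomorphisms between them. -/
@[simps]
def gnerve (i : A ⥤ Cat.{u, u}) : Cat.{u, u} ⥤ (Aᵒᵖ ⥤ Grpd.{u, u}) where
  obj C :=
    { obj a := Grpd.of (Core (i.obj a.unop ⥤ C))
      map f := ((Functor.whiskeringLeft _ _ C).obj (i.map f.unop).toFunctor).core
      map_id a := by
        rw [unop_id, i.map_id]
        rfl
      map_comp f g := by
        rw [unop_comp, i.map_comp]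
        rfl }
  map F := { app a := ((Functor.whiskeringRight _ _ _).obj F.toFunctor).core
             naturality _ _ _ := rfl }
  map_id _ := rfl
  map_comp _ _ := rfl

/-- `I_A^* : Cat ⥤ PshGrpd(A)`, `C ↦ (a ↦ Homi(A/a, C))`. -/
abbrev gelNerve (A : Type u) [SmallCategory A] : Cat.{u, u} ⥤ (Aᵒᵖ ⥤ Grpd.{u, u}) :=
  gnerve (Over.mapFunctor A)

lemma gel_map_toId_comp {a b c : A} (f : a ⟶ b) (g : b ⟶ c) {C : Type*} [Category* C]
    {P : Over a ⥤ C} {Q : Over b ⥤ C} {R : Over c ⥤ C}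
    (k : P ⟶ Over.map f ⋙ Q) (l : Q ⟶ Over.map g ⋙ R)
    (h : Core.mk (Over.map f ⋙ Over.map g ⋙ R) = Core.mk (Over.map (f ≫ g) ⋙ R)) :
    (k.app (Over.mk (𝟙 a)) ≫ l.app ((Over.map f).obj (Over.mk (𝟙 a))) ≫
      (CoreHom.iso (eqToHom h)).hom.app (Over.mk (𝟙 a))) ≫ R.map (toId (f ≫ g)) =
    (k.app (Over.mk (𝟙 a)) ≫ Q.map (toId f)) ≫
      l.app (Over.mk (𝟙 b)) ≫ R.map (toId g) := by
  have h₁ := l.naturality (toId f)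
  have h₂ : (CoreHom.iso (eqToHom h)).hom.app (Over.mk (𝟙 a)) ≫ R.map (toId (f ≫ g)) =
      R.map ((Over.map g).map (toId f)) ≫ R.map (toId g) := by
    refine (core_eqToHom_app_comp h (Over.mk (𝟙 a)) (R.map (toId (f ≫ g)))).trans ?_
    rw [toId_comp, R.map_comp, eqToHom_map, eqToHom_trans_assoc, eqToHom_refl, Category.id_comp,
      R.map_comp]
  rw [Category.assoc, Category.assoc, Category.assoc, h₂]
  refine congrArg (k.app (Over.mk (𝟙 a)) ≫ ·) ?_
  refine (Category.assoc _ _ _).symm.trans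
    ((congrArg (· ≫ R.map (toId g)) h₁.symm).trans (Category.assoc _ _ _))

/-- The component at `C` of the counit of `I_A ⊣ I_A^*`: it sends `(a, p : A/a ⥤ C)` to the value
of `p` at the terminal object `𝟙 a` of `A/a`. -/
@[simps]
def gelCounitFunctor (C : Cat.{u, u}) : GEl ((gelNerve A).obj C) ⥤ C where
  obj p := p.pt.of.obj (Over.mk (𝟙 p.base))
  map {p q} f := (CoreHom.iso f.fiber).hom.app (Over.mk (𝟙 p.base)) ≫ q.pt.of.map (toId f.hom)
  map_id p := by
    exact eq_of_heq ((core_eqToHom_app_comp_heq (GEl.res_id_obj _ p.pt).symm _ _).trans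
      (map_toId_id_heq _))
  map_comp {p q r} f g :=
    gel_map_toId_comp f.hom g.hom f.fiber.iso.hom g.fiber.iso.hom
      (GEl.res_comp_obj _ f.hom g.hom r.pt).symm

/-- The functor `X(a) ⥤ Homi(A/a, A//X)`. -/
def gelUnitApp (X : Aᵒᵖ ⥤ Grpd.{u, u}) (a : A) : X.obj (op a) ⥤ Core (Over a ⥤ GEl X) :=
  Core.functorToCore
    { obj x := GEl.fromOver x
      map k := GEl.fromOverMap k
      map_id := GEl.fromOverMap_id
      map_comp := GEl.fromOverMap_comp }

lemma GEl.fromOver_res {X : Aᵒᵖ ⥤ Grpd.{u, u}} {a b : A} (f : b ⟶ a) (x : X.obj (op a)) :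
    GEl.fromOver ((res X f).obj x) = Over.map f ⋙ GEl.fromOver x := by
  have h (p : Over b) : (GEl.fromOver ((res X f).obj x)).obj p =
      (Over.map f ⋙ GEl.fromOver x).obj p :=
    congrArg (GEl.mk p.left) (GEl.res_comp_obj X p.hom f x).symm
  exact CategoryTheory.Functor.hext h (fun p q g => GEl.hom_heq (h p) (h q) HEq.rfl
    (eqToHom_heq_eqToHom (GEl.res_over_obj _ g) (GEl.res_over_obj x ((Over.map f).map g))
      (GEl.res_comp_obj X p.hom f x).symm))

lemma gelUnitApp_naturality (X : Aᵒᵖ ⥤ Grpd.{u, u}) {a b : A} (f : b ⟶ a) :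
    res X f ⋙ gelUnitApp X b =
      gelUnitApp X a ⋙ ((Functor.whiskeringLeft _ _ (GEl X)).obj (Over.map f)).core := by
  refine CategoryTheory.Functor.hext (fun x => congrArg Core.mk (GEl.fromOver_res f x))
    (fun x y k => core_hom_heq (GEl.fromOver_res f x) (GEl.fromOver_res f y) (fun p => ?_))
  refine GEl.hom_heq (Functor.congr_obj (GEl.fromOver_res f x) p)
    (Functor.congr_obj (GEl.fromOver_res f y) p) HEq.rfl ?_
  refine (comp_eqToHom_heq _ _).trans (HEq.trans ?_ (comp_eqToHom_heq _ _).symm)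
  exact (Functor.hcongr_hom (res_comp X p.hom f) k).symm

lemma GEl.fromOver_comp {X Y : Aᵒᵖ ⥤ Grpd.{u, u}} (φ : X ⟶ Y) {a : A} (x : X.obj (op a)) :
    GEl.fromOver ((compAt φ a).obj x) = GEl.fromOver x ⋙ GEl.map φ := by
  have h' (p : Over a) : (res Y p.hom).obj ((compAt φ a).obj x) =
      (compAt φ p.left).obj ((res X p.hom).obj x) :=
    (Functor.congr_obj (res_comp_comp φ p.hom) x).symm
  have h (p : Over a) : (GEl.fromOver ((compAt φ a).obj x)).obj p =
      (GEl.fromOver x ⋙ GEl.map φ).obj p :=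
    congrArg (GEl.mk p.left) (h' p)
  refine CategoryTheory.Functor.hext h (fun p q g => GEl.hom_heq (h p) (h q) HEq.rfl ?_)
  refine HEq.trans ?_ (comp_eqToHom_heq _ _).symm
  refine HEq.trans ?_ (heq_of_eq (eqToHom_map (compAt φ p.left) (GEl.res_over_obj x g)).symm)
  exact eqToHom_heq_eqToHom (GEl.res_over_obj _ g) _ (h' p)

lemma comp_gelUnitApp {X Y : Aᵒᵖ ⥤ Grpd.{u, u}} (φ : X ⟶ Y) (a : A) :
    compAt φ a ⋙ gelUnitApp Y a =
      gelUnitApp X a ⋙ ((Functor.whiskeringRight _ _ _).obj (GEl.map φ)).core := by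
  refine CategoryTheory.Functor.hext (fun x => congrArg Core.mk (GEl.fromOver_comp φ x))
    (fun x y k => core_hom_heq (GEl.fromOver_comp φ x) (GEl.fromOver_comp φ y) (fun p => ?_))
  refine GEl.hom_heq (Functor.congr_obj (GEl.fromOver_comp φ x) p)
    (Functor.congr_obj (GEl.fromOver_comp φ y) p) HEq.rfl ?_
  refine (comp_eqToHom_heq _ _).trans (HEq.trans ?_ (comp_eqToHom_heq _ _).symm)
  refine HEq.trans ?_ (functor_map_comp_eqToHom_heq _ _ _).symm
  exact (Functor.hcongr_hom (res_comp_comp φ p.hom) k).symm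

/-- The unit of `I_A ⊣ I_A^*`. -/
def gelUnit : 𝟭 (Aᵒᵖ ⥤ Grpd.{u, u}) ⟶ gelFunctor A ⋙ gelNerve A where
  app X :=
    { app a := gelUnitApp X a.unop
      naturality _ _ f := gelUnitApp_naturality X f.unop }
  naturality _ _ φ := by
    ext a
    exact comp_gelUnitApp φ a.unop

lemma gelCounitFunctor_naturality {C D : Cat.{u, u}} (F : C ⟶ D) :
    GEl.map ((gelNerve A).map F) ⋙ gelCounitFunctor D = gelCounitFunctor C ⋙ F.toFunctor := by
  refine CategoryTheory.Functor.hext (fun p => rfl) (fun p q g => ?_)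
  refine (heq_of_eq (core_comp_eqToHom_app_comp _ _ _ _)).trans ?_
  refine HEq.trans ?_ (heq_of_eq (F.toFunctor.map_comp _ _).symm)
  refine heq_comp rfl rfl rfl HEq.rfl ?_
  exact eqToHom_comp_heq _ _

/-- The counit of `I_A ⊣ I_A^*`. -/
def gelCounit : gelNerve A ⋙ gelFunctor A ⟶ 𝟭 Cat.{u, u} where
  app C := (gelCounitFunctor C).toCatHom
  naturality _ _ F := Cat.ext (gelCounitFunctor_naturality F)

lemma gelMap_gelUnit_comp (X : Aᵒᵖ ⥤ Grpd.{u, u}) :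
    GEl.map (gelUnit.app X) ⋙ gelCounitFunctor (Cat.of (GEl X)) = 𝟭 (GEl X) := by
  have h (p : GEl X) : (GEl.map (gelUnit.app X) ⋙ gelCounitFunctor (Cat.of (GEl X))).obj p = p :=
    congrArg (GEl.mk p.base) (GEl.res_id_obj X p.pt)
  refine CategoryTheory.Functor.hext h (fun p q g => ?_)
  let n : p ⟶ ⟨p.base, (res X g.hom).obj q.pt⟩ :=
    ⟨𝟙 _, g.fiber ≫ eqToHom (GEl.res_id_obj X _).symm⟩
  let m : (⟨p.base, (res X g.hom).obj q.pt⟩ : GEl X) ⟶ q := ⟨g.hom, 𝟙 _⟩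
  have hnm : n ≫ m = g := by
    refine GEl.hom_ext (Category.id_comp g.hom) ?_
    exact comp_map_id_comp_heq (res X (𝟙 p.base)) g.fiber _ _
  refine (heq_of_eq (core_comp_eqToHom_app_comp _ _ _ _)).trans ?_
  refine HEq.trans ?_ (heq_of_eq hnm)
  refine heq_comp (h p) (congrArg (GEl.mk p.base) (GEl.res_id_obj X _)) (h q) ?_ ?_
  · refine GEl.hom_heq (h p) (congrArg (GEl.mk p.base) (GEl.res_id_obj X _)) HEq.rfl ?_
    refine (comp_eqToHom_heq _ _).trans (HEq.trans ?_ (comp_eqToHom_heq _ _).symm)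
    exact Functor.hcongr_hom (res_id X p.base) g.fiber
  · refine (eqToHom_comp_heq _ _).trans ?_
    have e : (res X (𝟙 p.base ≫ g.hom)).obj q.pt = (res X g.hom).obj q.pt := by
      rw [Category.id_comp]
    refine GEl.hom_heq (congrArg (GEl.mk p.base) e) (h q) HEq.rfl ?_
    exact eqToHom_heq_eqToHom
      (GEl.res_over_obj q.pt (toId g.hom)) rfl e

lemma gel_right_triangle_obj {C : Cat.{u, u}} {a : A} (P : Core (Over a ⥤ C)) :
    GEl.fromOver (X := (gelNerve A).obj C) (a := a) P ⋙ gelCounitFunctor C = P.of := by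
  refine CategoryTheory.Functor.hext (fun q => congrArg P.of.obj (over_map_id_mk q.hom))
    (fun q r g => ?_)
  refine (core_eqToHom_app_comp_heq (GEl.res_over_obj (X := (gelNerve A).obj C) P g) _ _).trans ?_
  exact functor_map_heq P.of (over_map_map_toId_obj g) (over_map_id_mk r.hom)
    (over_map_map_toId_heq g)

lemma gel_right_triangle (C : Cat.{u, u}) (a : A) :
    gelUnitApp ((gelNerve A).obj C) a ⋙
      ((Functor.whiskeringRight _ _ _).obj (gelCounitFunctor C)).core = 𝟭 _ := by
  refine CategoryTheory.Functor.hext (fun P => congrArg Core.mk (gel_right_triangle_obj P))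
    (fun P Q k => core_hom_heq (gel_right_triangle_obj P) (gel_right_triangle_obj Q) (fun p => ?_))
  refine (heq_of_eq (core_comp_eqToHom_app_comp _ _ _ _)).trans ?_
  refine (comp_eqToHom_comp_heq _ _ _ ?_
    (map_toId_id_heq (a := p.left) (Over.map p.hom ⋙ Q.of))).trans ?_
  · exact congrArg (fun X : Over p.left => Q.of.obj ((Over.map p.hom).obj X))
      (over_map_id_mk (𝟙 p.left))
  · exact natTrans_app_heq k.iso.hom (over_map_id_mk p.hom)

/-- The adjunction `I_A ⊣ I_A^*`. -/
def gelAdjunction (A : Type u) [SmallCategory A] : gelFunctor A ⊣ gelNerve A where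
  unit := gelUnit
  counit := gelCounit
  left_triangle_components X := Cat.ext (gelMap_gelUnit_comp X)
  right_triangle_components C := by
    ext a
    exact gel_right_triangle C a.unop

/-- The `W`-equivalences of presheaves of sets on `A`. -/
def pshWeq (W : MorphismProperty Cat.{u, u}) (A : Type u) [SmallCategory A] :
    MorphismProperty (Aᵒᵖ ⥤ Type u) :=
  W.inverseImage (elFunctor A)

/-- The `W`-equivalences of presheaves of groupoids on `A`. -/
def pshGrpdWeq (W : MorphismProperty Cat.{u, u}) (A : Type u) [SmallCategory A] :
    MorphismProperty (Aᵒᵖ ⥤ Grpd.{u, u}) :=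
  W.inverseImage (gelFunctor A)

/-- `A` is a `W`-weak test category: `i_A ⊣ i_A^*` is a homotopical equivalence. -/
def IsWeakTest (W : MorphismProperty Cat.{u, u}) (A : Type u) [SmallCategory A] : Prop :=
  IsHomotopicalEquivalence (pshWeq W A) W (elAdjunction A)

/-- `A` is a `W`-groupoidal weak test category: `I_A ⊣ I_A^*` is a homotopical equivalence. -/
def IsGroupoidalWeakTest (W : MorphismProperty Cat.{u, u}) (A : Type u) [SmallCategory A] : Prop :=
  IsHomotopicalEquivalence (pshGrpdWeq W A) W (gelAdjunction A)

end TestCat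

namespace TestCat

/-! Write e for the terminal category and call a small category aspherical if its functor to e is in
`W`. Both conditions of the theorem reduce to asphericity. Since the weak equivalences of presheaves
are created by the left adjoint, naturality of the counit and a triangle identity leave only the
counit to be checked. Its slice over c is a retract of the category of elements of the nerve of C/c,
which has a terminal object. So A is a weak test category iff A/i_A^*(C) is aspherical for every C
with a terminal object, and the same holds with I_A.

Weak test implies groupoidal weak test. Let J be the contractible groupoid on ℕ. A functor from J to
I_A^*(C)(a) is the same as a functor A/a ⥤ C^J, so `chains` of I_A^*(C) is i_A^*(C^J); its category
of elements is aspherical, because C^J has a terminal object when C does. It remains to pass from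
A/`chains X` to A//X for a presheaf of groupoids X. Between them lies `Chain X`, the category of
pairs (a, J ⥤ X(a)) in which chains may be reindexed by self-maps of ℕ. Its projection to the
one-object category `Shape` of such self-maps has slices containing A/`chains X` as a reflective
subcategory, and `Shape` is contractible, so `Chain X` is aspherical. Its evaluation at 0, with
values in A//X, has contractible slices. Both contractions insert a new zeroth term. This is why ℕ
is used: ℕ ≅ 1 + ℕ, so a chain with one more term has the same shape, and the single J does the work
of all simplices (`isAspherical_shape`, `consFunctor`, `isAspherical_gel`).

Converse. If D has no non-trivial isomorphisms, neither do the categories of functors A/a ⥤ D, and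
A//I_A^*(D) is equivalent to A/i_A^*(D) (`isEquivalence_elToGel`). For C with a terminal object, D =
A/i_A^*(C) inherits the absence of isomorphisms from A, also after a terminal object is adjoined,
and the unit and counit make i_A^*(C) a retract of the nerve of this enlarged D. -/

/-- A small category `A` is *`W`-aspherical* if `A ⥤ e` is in `W`. -/
def IsAspherical (W : MorphismProperty Cat.{u, u}) (A : Type u) [SmallCategory A] : Prop :=
  W (Functor.toCatHom (Functor.star A : A ⥤ Discrete PUnit.{u + 1}))

lemma star_unique {A : Type u} [SmallCategory A] (F G : A ⥤ Discrete PUnit.{u + 1}) : F = G :=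
  CategoryTheory.Functor.ext (fun _ => Subsingleton.elim _ _) (fun _ _ _ => Subsingleton.elim _ _)

/-! ### Aspherical categories, slices and retracts. -/

namespace IsBasicLocalizer

variable {W : MorphismProperty Cat.{u, u}} (hW : IsBasicLocalizer W)
  {A B C : Type u} [SmallCategory A] [SmallCategory B] [SmallCategory C]

include hW

lemma comp {F : A ⥤ B} {G : B ⥤ C} (hF : W F.toCatHom) (hG : W G.toCatHom) :
    W (F ⋙ G).toCatHom :=
  hW.weaklySaturated.twoOutOfThree.comp_mem _ _ hF hG

lemma of_postcomp {F : A ⥤ B} {G : B ⥤ C} (hG : W G.toCatHom) (h : W (F ⋙ G).toCatHom) :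
    W F.toCatHom :=
  hW.weaklySaturated.twoOutOfThree.of_postcomp F.toCatHom G.toCatHom hG h

lemma of_precomp {F : A ⥤ B} {G : B ⥤ C} (hF : W F.toCatHom) (h : W (F ⋙ G).toCatHom) :
    W G.toCatHom :=
  hW.weaklySaturated.twoOutOfThree.of_precomp F.toCatHom G.toCatHom hF h

lemma id (A : Type u) [SmallCategory A] : W (𝟭 A).toCatHom :=
  hW.weaklySaturated.isomorphisms_le _ (inferInstanceAs (IsIso (𝟙 (Cat.of A))))

lemma isAspherical [Limits.HasTerminal A] : IsAspherical W A := hW.of_hasTerminal A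

lemma isAspherical_of_mem {F : A ⥤ B} (hF : W F.toCatHom) (hB : IsAspherical W B) :
    IsAspherical W A := by
  rw [IsAspherical, star_unique (Functor.star A) (F ⋙ Functor.star B)]
  exact hW.comp hF hB

lemma isAspherical_of_mem' {F : A ⥤ B} (hF : W F.toCatHom) (hA : IsAspherical W A) :
    IsAspherical W B := by
  rw [IsAspherical, star_unique (Functor.star A) (F ⋙ Functor.star B)] at hA
  exact hW.of_precomp hF hA

lemma mem_of_isAspherical (F : A ⥤ B) (hA : IsAspherical W A) (hB : IsAspherical W B) :
    W F.toCatHom := by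
  rw [IsAspherical, star_unique (Functor.star A) (F ⋙ Functor.star B)] at hA
  exact hW.of_postcomp hB hA

/-- A functor with aspherical slices is in `W`. -/
lemma of_isAspherical_slices (F : A ⥤ B)
    (h : ∀ b : B, IsAspherical W (CostructuredArrow F b)) : W F.toCatHom :=
  -- Relative to the identity of `B`, the slices of `B` have terminal objects, so the induced
  -- functors go between aspherical categories.
  hW.of_slices F (𝟭 B) fun b => by
    have : Limits.HasTerminal (CostructuredArrow (𝟭 B) b) :=
      Limits.IsTerminal.hasTerminal CostructuredArrow.mkIdTerminal
    exact hW.mem_of_isAspherical (A := CostructuredArrow F b) _ (h b) hW.isAspherical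

lemma of_isLeftAdjoint (F : A ⥤ B) [F.IsLeftAdjoint] : W F.toCatHom :=
  hW.of_isAspherical_slices F fun b => by
    have := (isLeftAdjoint_iff_hasTerminal_costructuredArrow (F := F)).1 inferInstance b
    exact hW.isAspherical

/-- A retract of an aspherical category is aspherical. -/
lemma isAspherical_of_retract (i : A ⥤ B) (r : B ⥤ A) (h : i ⋙ r = 𝟭 A)
    (hB : IsAspherical W B) : IsAspherical W A :=
  hW.isAspherical_of_mem' (F := r)
    (hW.weaklySaturated.of_retraction i.toCatHom r.toCatHom (Cat.ext h)
      (hW.mem_of_isAspherical (r ⋙ i) hB hB)) hB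

end IsBasicLocalizer

/-! ### Natural transformations as homotopies. -/

/-- The functor `B ⥤ Arrow B` sending `b` to `𝟙 b`. -/
@[simps]
def arrowId (B : Type u) [SmallCategory B] : B ⥤ Arrow B where
  obj b := Arrow.mk (𝟙 b)
  map f := Arrow.homMk f f

/-- `arrowId B` is left adjoint to the functor sending an arrow to its source. -/
def arrowIdAdjunction (B : Type u) [SmallCategory B] : arrowId B ⊣ Arrow.leftFunc :=
  Adjunction.mkOfHomEquiv
    { homEquiv b f :=
        { toFun k := k.left
          invFun k := Arrow.homMk k (k ≫ f.hom) (Category.id_comp _).symm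
          left_inv k := by
            ext
            · rfl
            · exact (Arrow.w k).trans (Category.id_comp _)
          right_inv _ := rfl }
      homEquiv_naturality_left_symm f g :=
        Arrow.hom_ext _ _ rfl (Category.assoc _ _ _) }

/-- The functor `A ⥤ Arrow B` given by a natural transformation between functors `A ⥤ B`. -/
@[simps]
def toArrow {A B : Type u} [SmallCategory A] [SmallCategory B] {F G : A ⥤ B} (α : F ⟶ G) :
    A ⥤ Arrow B where
  obj a := Arrow.mk (α.app a)
  map f := Arrow.homMk (F.map f) (G.map f)

namespace IsBasicLocalizer

variable {W : MorphismProperty Cat.{u, u}} (hW : IsBasicLocalizer W)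
  {A B C : Type u} [SmallCategory A] [SmallCategory B] [SmallCategory C]

include hW

/-- Functors related by a natural transformation are in `W` simultaneously. -/
lemma mem_iff_of_natTrans {F G : A ⥤ B} (α : F ⟶ G) : W F.toCatHom ↔ W G.toCatHom := by
  -- `Arrow B` is a path object: the source and target functors have the common section `arrowId B`,
  -- a left adjoint, hence are in `W`. Both `F` and `G` factor through `toArrow α`.
  have hi : W (arrowId B).toCatHom :=
    have := (arrowIdAdjunction B).isLeftAdjoint
    hW.of_isLeftAdjoint _
  have hl : W (Arrow.leftFunc : Arrow B ⥤ B).toCatHom :=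
    hW.of_precomp (F := arrowId B) hi (hW.id B)
  have hr : W (Arrow.rightFunc : Arrow B ⥤ B).toCatHom :=
    hW.of_precomp (F := arrowId B) hi (hW.id B)
  exact ⟨fun h => hW.comp (F := toArrow α) (hW.of_postcomp hl h) hr,
    fun h => hW.comp (F := toArrow α) (hW.of_postcomp hr h) hl⟩

/-- A category with a zigzag of natural transformations from the identity to a constant functor is
aspherical. -/
lemma isAspherical_of_contraction (D : A ⥤ A) (α : D ⟶ 𝟭 A) (a : A)
    (β : D ⟶ (Functor.const A).obj a) : IsAspherical W A := by
  -- The constant functor at `a` factors through the point; once it is in `W`, weak saturation puts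
  -- the projection to the point in `W`.
  refine hW.weaklySaturated.of_retraction
    ((Functor.const (Discrete PUnit.{u + 1})).obj a).toCatHom
    (Functor.toCatHom (Functor.star A)) (Cat.ext (star_unique _ _)) ?_
  exact (hW.mem_iff_of_natTrans β).1 ((hW.mem_iff_of_natTrans α).2 (hW.id A))

end IsBasicLocalizer

/-! ### Reduction of homotopical equivalences to the counit. -/

section

variable {C : Type v} [Category.{w} C] {W : MorphismProperty Cat.{u, u}}

/-- An adjunction `L ⊣ R` with target `Cat` is a homotopical equivalence, for the weak equivalences
created by `L`, as soon as its counit is a pointwise weak equivalence. -/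
lemma isHomotopicalEquivalence_of_counit (hW : IsBasicLocalizer W) {L : C ⥤ Cat.{u, u}}
    {R : Cat.{u, u} ⥤ C} (adj : L ⊣ R) (h : ∀ X, W (adj.counit.app X)) :
    IsHomotopicalEquivalence (W.inverseImage L) W adj := by
  have := hW.weaklySaturated.twoOutOfThree
  refine ⟨fun f hf => hf, fun {X Y} f hf => ?_, h, fun Y => ?_⟩
  -- Two-out-of-three in the naturality square of the counit.
  · refine W.of_postcomp (L.map (R.map f)) (adj.counit.app Y) (h Y) ?_
    have e := adj.counit.naturality f
    dsimp at e
    rw [e]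
    exact W.comp_mem _ _ (h X) hf
  -- Two-out-of-three in the triangle identity.
  · refine W.of_postcomp (L.map (adj.unit.app Y)) (adj.counit.app (L.obj Y)) (h _) ?_
    have e : L.map (adj.unit.app Y) ≫ adj.counit.app (L.obj Y) = 𝟙 (L.obj Y) :=
      adj.left_triangle_components Y
    exact e ▸ hW.id (L.obj Y)

end

/-! ### Slices of the counit for presheaves of sets. -/

section

lemma costructuredArrow_hom_heq {B : Type*} {C : Type*} [Category* B] [Category* C] {S : B ⥤ C}
    {c : C} {X Y X' Y' : CostructuredArrow S c} (hX : X = X') (hY : Y = Y') {f : X ⟶ Y}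
    {g : X' ⟶ Y'} (h : f.left ≍ g.left) : f ≍ g := by
  subst hX
  subst hY
  exact heq_of_eq (CostructuredArrow.hom_ext _ _ (eq_of_heq h))

variable {A : Type u} [SmallCategory A]

/-- The morphism from an object of `A/a` to the terminal object `𝟙 a`. -/
abbrev toTerminal {a : A} (x : Over a) : x ⟶ Over.mk (𝟙 a) :=
  Over.homMk x.hom

lemma toTerminal_self (a : A) : toTerminal (Over.mk (𝟙 a)) = 𝟙 _ := by
  ext
  rfl

lemma map_toTerminal_toId {a b : A} (f : a ⟶ b) (x : Over a) :
    (Over.map f).map (toTerminal x) ≫ toId f = toTerminal ((Over.map f).obj x) := by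
  ext
  simp [toTerminal]

section

variable {C : Type u} [SmallCategory C] {c : C}

/-- The functor `A/a ⥤ C/c` determined by a functor `p : A/a ⥤ C` and a morphism
`p (𝟙 a) ⟶ c`. -/
@[simps]
def liftOver {a : A} (p : Over a ⥤ C) (h : p.obj (Over.mk (𝟙 a)) ⟶ c) : Over a ⥤ Over c where
  obj x := Over.mk (p.map (toTerminal x) ≫ h)
  map {x y} g := Over.homMk (p.map g) (by
    dsimp
    rw [← Category.assoc, ← p.map_comp]
    congr 2
    ext
    simp)

lemma map_toTerminal_self {a : A} (p : Over a ⥤ C) (h : p.obj (Over.mk (𝟙 a)) ⟶ c) :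
    p.map (toTerminal (Over.mk (𝟙 a))) ≫ h = h := by
  rw [toTerminal_self, p.map_id, Category.id_comp]

lemma map_toTerminal_comp {a b : A} (f : a ⟶ b) (p : Over b ⥤ C)
    (h : p.obj (Over.mk (𝟙 b)) ⟶ c) (x : Over a) :
    p.map ((Over.map f).map (toTerminal x)) ≫ p.map (toId f) ≫ h =
      p.map (toTerminal ((Over.map f).obj x)) ≫ h := by
  rw [← Category.assoc, ← p.map_comp, map_toTerminal_toId]

/-- The hypothesis `hh` is the commutative triangle of a morphism in a slice of the counit. It makes
the two structure maps to `c` agree, and the underlying functors to `C` agree by `hp`. -/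
lemma liftOver_eq {a b : A} {f : a ⟶ b} {p : Over a ⥤ C} {q : Over b ⥤ C}
    (hp : p = Over.map f ⋙ q) {h : p.obj (Over.mk (𝟙 a)) ⟶ c} {k : q.obj (Over.mk (𝟙 b)) ⟶ c}
    (hh : ((eqToHom hp).app (Over.mk (𝟙 a)) ≫ q.map (toId f)) ≫ k = h) :
    liftOver p h = Over.map f ⋙ liftOver q k := by
  subst hp
  obtain rfl : q.map (toId f) ≫ k = h := by simpa using hh
  have e (x : Over a) : (liftOver (Over.map f ⋙ q) (q.map (toId f) ≫ k)).obj x =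
      (Over.map f ⋙ liftOver q k).obj x :=
    congrArg Over.mk (map_toTerminal_comp f q k x)
  exact CategoryTheory.Functor.hext e (fun x y g => over_hom_heq (e x) (e y) HEq.rfl)

end

section El

variable (A) (C : Cat.{u, u}) (c : C)

/-- The functor `A/i_A^*(C/c) ⥤ (A/i_A^*C)/c`. -/
def elOverToSlice : El ((elNerve A).obj (Cat.of (Over c))) ⥤
    CostructuredArrow (elCounitFunctor (A := A) C) c where
  obj q := CostructuredArrow.mk
    (Y := (El.map ((elNerve A).map (Over.forget c).toCatHom)).obj q)
    (((elCounitFunctor (Cat.of (Over c))).obj q).hom)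
  map {q r} g := CostructuredArrow.homMk
    ((El.map ((elNerve A).map (Over.forget c).toCatHom)).map g) (by
      have h : (elCounitFunctor C).map
          ((El.map ((elNerve A).map (Over.forget c).toCatHom)).map g) =
          ((elCounitFunctor (Cat.of (Over c))).map g).left :=
        eq_of_heq (Functor.hcongr_hom (elCounitFunctor_naturality (Over.forget c).toCatHom) g)
      exact (congrArg (· ≫ ((elCounitFunctor (Cat.of (Over c))).obj r).hom) h).trans
        (Over.w ((elCounitFunctor (Cat.of (Over c))).map g)))
  map_id q := CostructuredArrow.hom_ext _ _
    (CategoryTheory.Functor.map_id (El.map ((elNerve A).map (Over.forget c).toCatHom)) q)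
  map_comp f g := CostructuredArrow.hom_ext _ _
    (CategoryTheory.Functor.map_comp (El.map ((elNerve A).map (Over.forget c).toCatHom)) f g)

/-- The functor `(A/i_A^*C)/c ⥤ A/i_A^*(C/c)`. -/
def elSliceToOver : CostructuredArrow (elCounitFunctor (A := A) C) c ⥤
    El ((elNerve A).obj (Cat.of (Over c))) where
  obj s := ⟨s.left.base, (liftOver s.left.pt.toFunctor s.hom).toCatHom⟩
  map {s t} g := ⟨g.left.hom, by
    exact Cat.ext (liftOver_eq (El.w_toFunctor g.left) (CostructuredArrow.w g)).symm⟩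
  map_id _ := rfl
  map_comp _ _ := rfl

/-- Only this composite is needed, since asphericity passes to retracts. On objects it evaluates the
lifted functor at `𝟙 a`, which returns the given structure map. -/
lemma elSliceToOver_comp : elSliceToOver A C c ⋙ elOverToSlice A C c = 𝟭 _ := by
  have e (s : CostructuredArrow (elCounitFunctor (A := A) C) c) :
      (elSliceToOver A C c ⋙ elOverToSlice A C c).obj s = s := by
    obtain ⟨⟨a, p⟩, ⟨⟨⟩⟩, h⟩ := s
    refine congrArg (fun k : (elCounitFunctor (A := A) C).obj ⟨a, p⟩ ⟶ c =>
      CostructuredArrow.mk k) ?_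
    exact map_toTerminal_self p.toFunctor h
  exact CategoryTheory.Functor.hext e (fun s t g => costructuredArrow_hom_heq (e s) (e t)
    (heq_of_eq (El.hom_ext rfl)))

end El

/-- If `i_A^*(C)` is aspherical whenever `C` has a terminal object, then `A` is a weak test
category. -/
lemma isWeakTest_of_isAspherical {W : MorphismProperty Cat.{u, u}} (hW : IsBasicLocalizer W)
    (h : ∀ (C : Type u) [SmallCategory C] [Limits.HasTerminal C],
      IsAspherical W (El ((elNerve A).obj (Cat.of C)))) : IsWeakTest W A := by
  refine isHomotopicalEquivalence_of_counit hW _ fun C => ?_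
  refine hW.of_isAspherical_slices (elCounitFunctor C) fun c => ?_
  have : Limits.HasTerminal (Over c) := Over.mkIdTerminal.hasTerminal
  -- The slice over `c` is a retract of A/i_A^*(C/c), to which `h` applies because C/c has a
  -- terminal object.
  exact hW.isAspherical_of_retract _ _ (elSliceToOver_comp A C c) (h (Over c))

/-- The counit is a functor in `W` from this category to `C`, and `C` is aspherical. -/
lemma IsWeakTest.isAspherical {W : MorphismProperty Cat.{u, u}} (hW : IsBasicLocalizer W)
    (h : IsWeakTest W A) (C : Type u) [SmallCategory C] [Limits.HasTerminal C] :
    IsAspherical W (El ((elNerve A).obj (Cat.of C))) :=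
  hW.isAspherical_of_mem (F := elCounitFunctor (Cat.of C)) (h.counit (Cat.of C))
    (hW.isAspherical (A := C))

lemma IsGroupoidalWeakTest.isAspherical {W : MorphismProperty Cat.{u, u}}
    (hW : IsBasicLocalizer W) (h : IsGroupoidalWeakTest W A) (C : Type u) [SmallCategory C]
    [Limits.HasTerminal C] : IsAspherical W (GEl ((gelNerve A).obj (Cat.of C))) :=
  hW.isAspherical_of_mem (F := gelCounitFunctor (Cat.of C)) (h.counit (Cat.of C))
    (hW.isAspherical (A := C))

end

/-! ### Slices of the counit for presheaves of groupoids. -/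

section

variable {A : Type u} [SmallCategory A]

lemma core_eqToHom_app {D : Type*} {E : Type*} [Category* D] [Category* E]
    {P Q : Core (D ⥤ E)} (h : P = Q) (X : D) :
    (CoreHom.iso (eqToHom h)).hom.app X = eqToHom (by rw [h]) := by
  subst h
  rfl

lemma core_over_hom_ext {D : Type*} {E : Type*} [Category* D] [Category* E] {c : E}
    {P Q : Core (D ⥤ Over c)} {k l : P ⟶ Q}
    (h : ∀ X, (k.iso.hom.app X).left = (l.iso.hom.app X).left) : k = l :=
  Core.hom_ext (NatTrans.ext (funext fun X => Over.OverMorphism.ext (h X)))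

lemma core_eqToHom_app_left {D : Type*} {E : Type*} [Category* D] [Category* E] {c : E}
    {P Q : Core (D ⥤ Over c)} (h : P = Q) (X : D) :
    ((CoreHom.iso (eqToHom h)).hom.app X).left = eqToHom (by rw [h]) := by
  subst h
  rfl

section

variable {C : Type u} [SmallCategory C] {c : C}

/-- A natural isomorphism `k : p ≅ A/f ⋙ q` of functors `A/a ⥤ C` lifts to functors `A/a ⥤ C/c`. -/
def liftOverIso {a b : A} {f : a ⟶ b} {p : Over a ⥤ C} {q : Over b ⥤ C}
    (k : p ≅ Over.map f ⋙ q) {h : p.obj (Over.mk (𝟙 a)) ⟶ c} {l : q.obj (Over.mk (𝟙 b)) ⟶ c}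
    (w : (k.hom.app (Over.mk (𝟙 a)) ≫ q.map (toId f)) ≫ l = h) :
    liftOver p h ≅ Over.map f ⋙ liftOver q l :=
  NatIso.ofComponents (fun x => Over.isoMk (k.app x) (by
      subst w
      have h₁ := k.hom.naturality (toTerminal x)
      have h₂ := map_toTerminal_comp f q l x
      change k.hom.app x ≫ q.map (toTerminal _) ≫ l = p.map (toTerminal x) ≫ _
      dsimp at h₁
      rw [← h₂, Category.assoc, reassoc_of% h₁]))
    (fun g => by
      ext
      exact k.hom.naturality g)

end

section GEl

variable (A) (C : Cat.{u, u}) (c : C)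

/-- The functor `A//I_A^*(C/c) ⥤ (A//I_A^*C)/c`. -/
def gelOverToSlice : GEl ((gelNerve A).obj (Cat.of (Over c))) ⥤
    CostructuredArrow (gelCounitFunctor (A := A) C) c where
  obj q := CostructuredArrow.mk
    (Y := (GEl.map ((gelNerve A).map (Over.forget c).toCatHom)).obj q)
    (((gelCounitFunctor (Cat.of (Over c))).obj q).hom)
  map {q r} g := CostructuredArrow.homMk
    ((GEl.map ((gelNerve A).map (Over.forget c).toCatHom)).map g) (by
      have h : (gelCounitFunctor C).map
          ((GEl.map ((gelNerve A).map (Over.forget c).toCatHom)).map g) =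
          ((gelCounitFunctor (Cat.of (Over c))).map g).left :=
        eq_of_heq (Functor.hcongr_hom (gelCounitFunctor_naturality (Over.forget c).toCatHom) g)
      exact (congrArg (· ≫ ((gelCounitFunctor (Cat.of (Over c))).obj r).hom) h).trans
        (Over.w ((gelCounitFunctor (Cat.of (Over c))).map g)))
  map_id q := CostructuredArrow.hom_ext _ _
    (CategoryTheory.Functor.map_id (GEl.map ((gelNerve A).map (Over.forget c).toCatHom)) q)
  map_comp f g := CostructuredArrow.hom_ext _ _
    (CategoryTheory.Functor.map_comp (GEl.map ((gelNerve A).map (Over.forget c).toCatHom)) f g)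

/-- The functor `(A//I_A^*C)/c ⥤ A//I_A^*(C/c)`. -/
def gelSliceToOver : CostructuredArrow (gelCounitFunctor (A := A) C) c ⥤
    GEl ((gelNerve A).obj (Cat.of (Over c))) where
  obj s := ⟨s.left.base, Core.mk (liftOver s.left.pt.of s.hom)⟩
  map {s t} g := ⟨g.left.hom, CoreHom.mk (liftOverIso g.left.fiber.iso (CostructuredArrow.w g))⟩
  map_id s := by
    -- Equality of transformations with values in C/c is tested in `C`, where both sides become
    -- transports along an equality of the same objects.
    refine GEl.hom_ext rfl (heq_of_eq (core_over_hom_ext fun x => ?_))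
    exact (core_eqToHom_app (GEl.res_id_obj _ s.left.pt).symm x).trans
      (core_eqToHom_app_left (E := C) (GEl.res_id_obj ((gelNerve A).obj (Cat.of (Over c)))
        (Core.mk (liftOver s.left.pt.of s.hom))).symm x).symm
  map_comp {r s t} f g := by
    refine GEl.hom_ext rfl (heq_of_eq (core_over_hom_ext fun x => ?_))
    refine congrArg (fun e => f.left.fiber.iso.hom.app x ≫
      g.left.fiber.iso.hom.app ((Over.map f.left.hom).obj x) ≫ e) ?_
    exact (core_eqToHom_app (GEl.res_comp_obj _ f.left.hom g.left.hom t.left.pt).symm x).trans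
      (core_eqToHom_app_left (E := C) (GEl.res_comp_obj ((gelNerve A).obj (Cat.of (Over c)))
        f.left.hom g.left.hom (Core.mk (liftOver t.left.pt.of t.hom))).symm x).symm

lemma gelSliceToOver_comp : gelSliceToOver A C c ⋙ gelOverToSlice A C c = 𝟭 _ := by
  have e (s : CostructuredArrow (gelCounitFunctor (A := A) C) c) :
      (gelSliceToOver A C c ⋙ gelOverToSlice A C c).obj s = s := by
    obtain ⟨⟨a, p⟩, ⟨⟨⟩⟩, h⟩ := s
    refine congrArg (fun k : (gelCounitFunctor (A := A) C).obj ⟨a, p⟩ ⟶ c =>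
      CostructuredArrow.mk k) ?_
    exact map_toTerminal_self p.of h
  exact CategoryTheory.Functor.hext e (fun s t g => costructuredArrow_hom_heq (e s) (e t)
    (heq_of_eq (GEl.hom_ext rfl (comp_eqToHom_heq _ _))))

end GEl

/-- If `I_A^*(C)` is aspherical whenever `C` has a terminal object, then `A` is a groupoidal weak
test category. -/
lemma isGroupoidalWeakTest_of_isAspherical {W : MorphismProperty Cat.{u, u}}
    (hW : IsBasicLocalizer W)
    (h : ∀ (C : Type u) [SmallCategory C] [Limits.HasTerminal C],
      IsAspherical W (GEl ((gelNerve A).obj (Cat.of C)))) : IsGroupoidalWeakTest W A := by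
  refine isHomotopicalEquivalence_of_counit hW _ fun C => ?_
  refine hW.of_isAspherical_slices (gelCounitFunctor C) fun c => ?_
  have : Limits.HasTerminal (Over c) := Over.mkIdTerminal.hasTerminal
  exact hW.isAspherical_of_retract _ _ (gelSliceToOver_comp A C c) (h (Over c))

end

/-! ### Categories without non-trivial isomorphisms, and the converse. -/

section

section

variable {C : Type v} [Category.{w} C]

lemma hasNoNontrivialIso_iff :
    HasNoNontrivialIso C ↔ ∀ {x y : C} (e : x ≅ y), ∃ h : x = y, e.hom = eqToHom h := by
  refine ⟨fun hC x y e => ?_, fun hC x y f hf => ?_⟩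
  · have h : MorphismProperty.identities C e.hom :=
      hC _ (MorphismProperty.isomorphisms.infer_property e.hom)
    generalize e.hom = f at h
    obtain ⟨x⟩ := h
    exact ⟨rfl, rfl⟩
  · have : IsIso f := hf
    obtain ⟨rfl, h⟩ := hC (asIso f)
    obtain rfl : f = 𝟙 x := h
    exact ⟨x⟩

/-- No morphism goes from the adjoined object back to `C`, so no new isomorphism arises. -/
lemma HasNoNontrivialIso.withTerminal (hC : HasNoNontrivialIso C) :
    HasNoNontrivialIso (WithTerminal C) := by
  rw [hasNoNontrivialIso_iff] at hC ⊢
  rintro (x | _) (y | _) e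
  · obtain ⟨rfl, h⟩ := hC (x := x) (y := y) ⟨WithTerminal.down e.hom, WithTerminal.down e.inv,
      e.hom_inv_id, e.inv_hom_id⟩
    exact ⟨rfl, h⟩
  · exact (WithTerminal.false_of_from_star e.inv).elim
  · exact (WithTerminal.false_of_from_star e.hom).elim
  · exact ⟨rfl, Subsingleton.elim _ _⟩

lemma HasNoNontrivialIso.functor (hC : HasNoNontrivialIso C) (D : Type*) [Category* D] :
    HasNoNontrivialIso (D ⥤ C) := by
  rw [hasNoNontrivialIso_iff] at hC ⊢
  intro F G e
  have hX (X : D) := hC (e.app X)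
  have h : F = G := CategoryTheory.Functor.ext (fun X => (hX X).1) (fun X Y f => by
    have hY := (hX Y).2
    have hX' := (hX X).2
    dsimp at hY hX'
    rw [← hX', ← NatTrans.naturality_assoc, hY]
    simp)
  refine ⟨h, ?_⟩
  ext X
  rw [eqToHom_app]
  exact (hX X).2

end

variable {A : Type u} [SmallCategory A]

/-- The underlying isomorphism of `A` is an identity, and restriction along an identity leaves the
point unchanged. -/
lemma HasNoNontrivialIso.el (hA : HasNoNontrivialIso A) (X : Aᵒᵖ ⥤ Type u) :
    HasNoNontrivialIso (El X) := by
  rw [hasNoNontrivialIso_iff] at hA ⊢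
  rintro ⟨a, x⟩ ⟨b, y⟩ e
  obtain ⟨h, he⟩ := hA (x := a) (y := b) ⟨e.hom.hom, e.inv.hom,
    congrArg El.Hom.hom e.hom_inv_id, congrArg El.Hom.hom e.inv_hom_id⟩
  subst h
  obtain ⟨f, hf⟩ : ∃ f, f = e.hom := ⟨_, rfl⟩
  rw [← hf]
  have hw := f.w
  obtain rfl : y = x := by
    have : f.hom = 𝟙 a := by rw [hf]; exact he
    rw [this] at hw
    simpa using hw
  exact ⟨rfl, El.hom_ext (by rw [hf]; exact he)⟩

lemma eqToHom_comp_map_eqToHom_comp_eqToHom {D : Type*} {E : Type*} [Category* D] [Category* E]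
    (F : D ⥤ E) {x y : D} {z w : E} (h₁ : z = F.obj x) (h₂ : x = y) (h₃ : F.obj y = w)
    (h : z = w) : eqToHom h₁ ≫ F.map (eqToHom h₂) ≫ eqToHom h₃ = eqToHom h := by
  simp [eqToHom_map]

lemma core_eqToHom_eq {C : Type*} [Category* C] {P Q : Core C} (h : P = Q) (k : P ⟶ Q)
    (h' : P.of = Q.of) (hk : k.iso.hom = eqToHom h') : eqToHom h = k := by
  subst h
  exact Core.hom_ext hk.symm

/-- The comparison functor `A/i_A^*(C) ⥤ A//I_A^*(C)`. -/
def elToGel (C : Cat.{u, u}) : El ((elNerve A).obj C) ⥤ GEl ((gelNerve A).obj C) where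
  obj p := ⟨p.base, Core.mk p.pt.toFunctor⟩
  map f := ⟨f.hom, eqToHom (congrArg Core.mk (El.w_toFunctor f))⟩
  map_comp f g := GEl.hom_ext rfl (heq_of_eq
    (eqToHom_comp_map_eqToHom_comp_eqToHom (res ((gelNerve A).obj C) f.hom)
      (congrArg Core.mk (El.w_toFunctor f)) (congrArg Core.mk (El.w_toFunctor g)) _
      (congrArg Core.mk (El.w_toFunctor (f ≫ g)))).symm)

/-- Only fullness uses `hC`: the fiber component of a morphism is a natural isomorphism of functors
to `C`, hence an identity, and the morphism comes from A/i_A^*(C). -/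
lemma isEquivalence_elToGel {C : Cat.{u, u}} (hC : HasNoNontrivialIso C) :
    (elToGel (A := A) C).IsEquivalence where
  faithful := ⟨fun {p q f g} h => El.hom_ext (congrArg GEl.Hom.hom h)⟩
  full := ⟨fun {p q} f => by
    obtain ⟨h, hf⟩ := hasNoNontrivialIso_iff.1 (hC.functor (Over p.base)) f.fiber.iso
    refine ⟨⟨f.hom, Cat.ext h.symm⟩, GEl.hom_ext rfl (heq_of_eq ?_)⟩
    exact core_eqToHom_eq (congrArg Core.mk h) f.fiber h hf⟩
  essSurj := ⟨fun q => ⟨⟨q.base, q.pt.of.toCatHom⟩, ⟨Iso.refl _⟩⟩⟩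

/-- The category `A/i_A^*(C)` is a retract of `A/i_A^*(D)`, for `D = A/i_A^*(C)` with a terminal object
adjoined, if `C` has a terminal object. -/
lemma isWeakTest_of_isGroupoidalWeakTest {W : MorphismProperty Cat.{u, u}}
    (hW : IsBasicLocalizer W) (hA : HasNoNontrivialIso A) (h : IsGroupoidalWeakTest W A) :
    IsWeakTest W A := by
  refine isWeakTest_of_isAspherical hW fun C _ _ => ?_
  let R := elNerve A
  let D := Cat.of (El (R.obj (Cat.of C)))
  let i : D ⟶ Cat.of (WithTerminal D) := (WithTerminal.incl : D ⥤ WithTerminal D).toCatHom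
  -- `D` need not have a terminal object, so one is adjoined to make `h` applicable. The counit
  -- still extends, the new object going to the terminal object of `C`.
  let r : Cat.of (WithTerminal D) ⟶ Cat.of C := (WithTerminal.liftToTerminal
    (elCounitFunctor (Cat.of C)) (Limits.terminalIsTerminal (C := C))).toCatHom
  have hir : i ≫ r = (elAdjunction A).counit.app (Cat.of C) :=
    Cat.ext (CategoryTheory.Functor.hext (fun _ => rfl) (fun _ _ _ => HEq.rfl))
  let s : R.obj (Cat.of C) ⟶ R.obj (Cat.of (WithTerminal D)) :=
    (elAdjunction A).unit.app (R.obj (Cat.of C)) ≫ R.map i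
  have hs : s ≫ R.map r = 𝟙 _ :=
    (Category.assoc _ _ _).trans ((congrArg ((elAdjunction A).unit.app (R.obj (Cat.of C)) ≫ ·)
      ((R.map_comp i r).symm.trans (congrArg R.map hir))).trans
      ((elAdjunction A).right_triangle_components (Cat.of C)))
  -- The hypothesis on `A` enters here: `D` has no non-trivial isomorphisms, so asphericity
  -- transfers along the comparison functor.
  have hD : IsAspherical W (El (R.obj (Cat.of (WithTerminal D)))) := by
    have := isEquivalence_elToGel (A := A) (C := Cat.of (WithTerminal D))
      (hA.el _).withTerminal
    exact hW.isAspherical_of_mem (hW.of_isLeftAdjoint (elToGel (Cat.of (WithTerminal D))))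
      (h.isAspherical hW (WithTerminal D))
  refine hW.isAspherical_of_retract (El.map s) (El.map (R.map r)) ?_ hD
  have := congrArg (fun f => ((elFunctor A).map f).toFunctor) hs
  exact this.trans (congrArg Cat.Hom.toFunctor ((elFunctor A).map_id (R.obj (Cat.of C))))

end

/-! ### Chains: functors from the contractible groupoid on ℕ. -/

section

/-- The contractible groupoid with set of objects `ℕ`. -/
abbrev CodiscreteNat : Type := Codiscrete ℕ

namespace CodiscreteNat

/-- The functor given by a map `ℕ → ℕ`. -/
abbrev fn (φ : ℕ → ℕ) : CodiscreteNat ⥤ CodiscreteNat := Codiscrete.functorOfFun φ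

/-- The unique morphism `m ⟶ n`. -/
abbrev arr (m n : ℕ) : (Codiscrete.mk m : CodiscreteNat) ⟶ Codiscrete.mk n := (Codiscrete.iso _ _).hom

lemma functor_ext {G : Type v} [Category.{w} G] {F F' : CodiscreteNat ⥤ G}
    (h : ∀ n, F.obj ⟨n⟩ = F'.obj ⟨n⟩) (h' : ∀ m n, F.map (arr m n) ≍ F'.map (arr m n)) : F = F' :=
  CategoryTheory.Functor.hext (fun x => h x.as) (fun x y _ => h' x.as y.as)

section

variable {G : Type v} [Groupoid.{w} G]

/-- The objects of `cons σ k`. -/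
def consObj (σ : CodiscreteNat ⥤ G) (g : G) : ℕ → G
  | 0 => g
  | n + 1 => σ.obj ⟨n⟩

/-- The morphisms to `0` of `cons σ k`. -/
def consHom (σ : CodiscreteNat ⥤ G) {g : G} (k : σ.obj ⟨0⟩ ⟶ g) : ∀ n, consObj σ g n ⟶ g
  | 0 => 𝟙 g
  | n + 1 => σ.map (arr n 0) ≫ k

/-- The functor which sends `0` to `g` and extends a shift of `σ`. -/
@[simps]
def cons (σ : CodiscreteNat ⥤ G) {g : G} (k : σ.obj ⟨0⟩ ⟶ g) : CodiscreteNat ⥤ G where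
  obj x := consObj σ g x.as
  map {x y} _ := consHom σ k x.as ≫ Groupoid.inv (consHom σ k y.as)

/-- Between successors the factor `k` cancels against its inverse. -/
lemma fn_succ_cons (σ : CodiscreteNat ⥤ G) {g : G} (k : σ.obj ⟨0⟩ ⟶ g) :
    fn Nat.succ ⋙ cons σ k = σ := by
  refine functor_ext (fun _ => rfl) (fun m n => heq_of_eq ?_)
  change (σ.map (arr m 0) ≫ k) ≫ Groupoid.inv (σ.map (arr n 0) ≫ k) = σ.map (arr m n)
  have : σ.map (arr m 0) = σ.map (arr m n) ≫ σ.map (arr n 0) := (σ.map_comp (arr m n) (arr n 0))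
  rw [this]
  simp

lemma fn_zero_cons (σ : CodiscreteNat ⥤ G) {g : G} (k : σ.obj ⟨0⟩ ⟶ g) :
    fn (fun _ => 0) ⋙ cons σ k = (Functor.const _).obj g := by
  refine functor_ext (fun _ => rfl) (fun m n => heq_of_eq ?_)
  exact Groupoid.comp_inv (𝟙 g)

lemma cons_map_zero_zero (σ : CodiscreteNat ⥤ G) {g : G} (k : σ.obj ⟨0⟩ ⟶ g) :
    (cons σ k).map (arr 0 0) = 𝟙 g :=
  Groupoid.comp_inv (𝟙 g)

lemma cons_map_succ_zero (σ : CodiscreteNat ⥤ G) {g : G} (k : σ.obj ⟨0⟩ ⟶ g) (n : ℕ) :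
    (cons σ k).map (arr (n + 1) 0) = σ.map (arr n 0) ≫ k := by
  change (σ.map (arr n 0) ≫ k) ≫ Groupoid.inv (𝟙 g) = _
  simp

/-- Every arrow of the contractible groupoid factors through 0, and the arrow from n + 1 to 0
factors through 1. A chain is thus determined by its shift and its value on the arrow from 1 to 0.
-/
lemma cons_uncons (F : CodiscreteNat ⥤ G) :
    cons (fn Nat.succ ⋙ F) (F.map (arr 1 0)) = F := by
  have ho (n : ℕ) : consObj (fn Nat.succ ⋙ F) (F.obj ⟨0⟩) n = F.obj ⟨n⟩ := by cases n <;> rfl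
  have hm (n : ℕ) : consHom (fn Nat.succ ⋙ F) (F.map (arr 1 0)) n = eqToHom (ho n) ≫
      F.map (arr n 0) := by
    cases n with
    | zero => exact (((Category.id_comp _)).trans (F.map_id _)).symm
    | succ n => exact (F.map_comp (arr (n + 1) 1) (arr 1 0)).symm.trans (Category.id_comp _).symm
  refine functor_ext ho (fun m n => ?_)
  have h : F.map (arr m 0) = F.map (arr m n) ≫ F.map (arr n 0) := F.map_comp (arr m n) (arr n 0)
  change consHom (fn Nat.succ ⋙ F) (F.map (arr 1 0)) m ≫
    Groupoid.inv (consHom (fn Nat.succ ⋙ F) (F.map (arr 1 0)) n) ≍ _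
  rw [hm, hm, h]
  simp

/-- Two functors agree if they agree at `0`, after a shift, and on `1 ⟶ 0`. -/
lemma functor_ext_succ {F F' : CodiscreteNat ⥤ G} (h₀ : F.obj ⟨0⟩ = F'.obj ⟨0⟩)
    (h : fn Nat.succ ⋙ F = fn Nat.succ ⋙ F') (h' : F.map (arr 1 0) ≍ F'.map (arr 1 0)) :
    F = F' := by
  have aux {σ σ' : CodiscreteNat ⥤ G} {g g' : G} (hσ : σ = σ') (hg : g = g')
      {k : σ.obj ⟨0⟩ ⟶ g} {k' : σ'.obj ⟨0⟩ ⟶ g'} (hk : k ≍ k') : cons σ k = cons σ' k' := by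
    subst hσ hg
    rw [eq_of_heq hk]
  rw [← cons_uncons F, ← cons_uncons F']
  exact aux h h₀ h'

end

/-- The self-map of `ℕ` which fixes `0` and is conjugate to `φ` on the successors. -/
def shift (φ : ℕ → ℕ) : ℕ → ℕ
  | 0 => 0
  | n + 1 => φ n + 1

end CodiscreteNat

open CodiscreteNat

/-- The category with one object and with the maps `ℕ → ℕ` as morphisms, with composition
reversed. -/
structure Shape : Type u where

instance : SmallCategory Shape.{u} where
  Hom _ _ := ULift.{u} (ℕ → ℕ)
  id _ := ⟨_root_.id⟩
  comp φ ψ := ⟨φ.down ∘ ψ.down⟩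

/-- The endofunctor of `Shape` given by `shift`. -/
def Shape.shift : Shape.{u} ⥤ Shape.{u} where
  obj s := s
  map φ := ⟨CodiscreteNat.shift φ.down⟩
  map_id _ := congrArg ULift.up (funext fun n => by cases n <;> rfl)
  map_comp _ _ := congrArg ULift.up (funext fun n => by cases n <;> rfl)

/-- Naturality of the two transformations says that `shift φ` extends `φ` along the successor map
and fixes 0; they contract `Shape`. -/
lemma IsBasicLocalizer.isAspherical_shape {W : MorphismProperty Cat.{u, u}}
    (hW : IsBasicLocalizer W) : IsAspherical W Shape.{u} :=
  hW.isAspherical_of_contraction Shape.shift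
    { app _ := ⟨Nat.succ⟩ } ⟨⟩ { app _ := ⟨fun _ => 0⟩ }

variable {A : Type u} [SmallCategory A]

/-- The presheaf of sets `a ↦ Hom(J, X(a))`, for `J` the contractible groupoid on `ℕ`. -/
def chains (X : Aᵒᵖ ⥤ Grpd.{u, u}) : Aᵒᵖ ⥤ Type u where
  obj a := CodiscreteNat ⥤ X.obj a
  map f := ↾(fun σ => σ ⋙ (res X f.unop))
  map_id a := by
    ext σ
    exact congrArg (σ ⋙ ·) (res_id X a.unop)
  map_comp f g := by
    ext σ
    exact congrArg (σ ⋙ ·) (res_comp X g.unop f.unop)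

/-- Pairs of an object `a` of `A` and a functor `J ⥤ X(a)`. -/
structure Chain (X : Aᵒᵖ ⥤ Grpd.{u, u}) : Type u where
  base : A
  pt : CodiscreteNat ⥤ X.obj (op base)

/-- Morphisms of pairs, contravariant in `J`. -/
@[ext]
structure Chain.Hom {X : Aᵒᵖ ⥤ Grpd.{u, u}} (p q : Chain X) : Type u where
  idx : ℕ → ℕ
  hom : p.base ⟶ q.base
  w : fn idx ⋙ p.pt = q.pt ⋙ res X hom

namespace Chain

variable {X : Aᵒᵖ ⥤ Grpd.{u, u}}

instance : SmallCategory (Chain X) where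
  Hom p q := Chain.Hom p q
  id p := ⟨_root_.id, 𝟙 _, congrArg (p.pt ⋙ ·) (res_id X p.base).symm⟩
  comp {p q r} f g := ⟨f.idx ∘ g.idx, f.hom ≫ g.hom,
    (congrArg (fn g.idx ⋙ ·) f.w).trans ((congrArg (· ⋙ res X f.hom) g.w).trans
      (congrArg (r.pt ⋙ ·) (res_comp X f.hom g.hom).symm))⟩

@[ext] lemma hom_ext {p q : Chain X} {f g : p ⟶ q} (h : f.idx = g.idx) (h' : f.hom = g.hom) :
    f = g := Chain.Hom.ext h h'

variable (X)

/-- The projection to `Shape`. -/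
def shape : Chain X ⥤ Shape.{u} where
  obj _ := ⟨⟩
  map f := ⟨f.idx⟩

/-- The reflection of a slice of `shape X` onto `A/chains X`. -/
def sliceToEl (s : Shape.{u}) : CostructuredArrow (shape X) s ⥤ El (chains X) where
  obj p := ⟨p.left.base, fn (ULift.down p.hom) ⋙ p.left.pt⟩
  map {p q} g := ⟨g.left.hom, by
    have h : g.left.idx ∘ (ULift.down q.hom) = ULift.down p.hom :=
      congrArg ULift.down (CostructuredArrow.w g)
    rw [← h]
    exact congrArg (fn (ULift.down q.hom) ⋙ ·) g.left.w.symm⟩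

/-- The inclusion of `A/chains X` into a slice of `shape X`. -/
def elToSlice (s : Shape.{u}) : El (chains X) ⥤ CostructuredArrow (shape X) s where
  obj p := CostructuredArrow.mk (Y := ⟨p.base, p.pt⟩) (ULift.up _root_.id)
  map {p q} g := by
    exact CostructuredArrow.homMk
      (show (⟨p.base, p.pt⟩ : Chain X) ⟶ ⟨q.base, q.pt⟩ from ⟨_root_.id, g.hom, g.w.symm⟩) rfl

/-- `A/chains X` is a reflective subcategory of the slices of `shape X`. -/
def sliceAdjunction (s : Shape.{u}) : sliceToEl X s ⊣ elToSlice X s :=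
  Adjunction.mkOfHomEquiv
    { homEquiv p q :=
        -- The index map is forced: the structure map of an object in the image of `elToSlice` is
        -- the identity of ℕ, so commutation of the triangle makes the index equal to the structure
        -- map of `p`.
        { toFun g := CostructuredArrow.homMk ⟨ULift.down p.hom, g.hom, g.w.symm⟩ rfl
          invFun k := ⟨k.left.hom, by
            have h : k.left.idx = ULift.down p.hom :=
              congrArg ULift.down (CostructuredArrow.w k)
            exact k.left.w.symm.trans (h ▸ rfl)⟩
          left_inv _ := rfl
          right_inv k := CostructuredArrow.hom_ext _ _ (Chain.hom_ext
            (congrArg ULift.down (CostructuredArrow.w k)).symm rfl) }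
      homEquiv_naturality_left_symm _ _ := rfl
      homEquiv_naturality_right _ _ := CostructuredArrow.hom_ext _ _ (Chain.hom_ext rfl rfl) }

/-- Each slice of `shape X` maps by a left adjoint to A/`chains X`, so `shape X` has aspherical
slices and its target is aspherical. -/
lemma isAspherical {W : MorphismProperty Cat.{u, u}} (hW : IsBasicLocalizer W)
    (h : IsAspherical W (El (chains X))) : IsAspherical W (Chain X) := by
  refine hW.isAspherical_of_mem (F := shape X) ?_ hW.isAspherical_shape
  refine hW.of_isAspherical_slices _ fun s => ?_
  have := (sliceAdjunction X s).isLeftAdjoint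
  exact hW.isAspherical_of_mem (hW.of_isLeftAdjoint (sliceToEl X s)) h

end Chain

end

/-! ### Evaluation of chains at 0, and the direct implication. -/

section

open CodiscreteNat

variable {A : Type u} [SmallCategory A]

lemma comp_comp_eqToHom_heq {D : Type*} [Category* D] {x y z w : D} (f : x ⟶ y) (g : y ⟶ z)
    (h : z = w) : f ≫ g ≫ eqToHom h ≍ f ≫ g := by
  subst h
  simp

lemma comp_map_comp_heq_id {D : Type*} [Category* D] {F : D ⥤ D} (hF : F = 𝟭 D) {x y z : D}
    (k : x ⟶ y) (l : y ⟶ x) (hl : l ≫ k = 𝟙 y) (h₁ : x = F.obj x) (h₂ : F.obj y = z) :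
    (l ≫ eqToHom h₁) ≫ F.map k ≫ eqToHom h₂ ≍ 𝟙 y := by
  subst hF
  subst h₂
  simp [hl]

/-- The image of the arrow from 0 to n is invertible, so it can be moved to the other side. -/
lemma map_comp_heq_of_heq {G : Type*} [Category* G] (σ : CodiscreteNat ⥤ G) {n : ℕ} {g g' z : G}
    (k : σ.obj ⟨0⟩ ⟶ g) (e : σ.obj ⟨n⟩ = z) (l : z ⟶ g') (hg : g = g')
    (h : (σ.map (arr 0 n) ≫ eqToHom e) ≫ l ≍ k) : σ.map (arr n 0) ≫ k ≍ l := by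
  subst hg
  subst e
  obtain rfl := eq_of_heq h
  have : σ.map (arr n 0) ≫ σ.map (arr 0 n) = 𝟙 _ :=
    (σ.map_comp (arr n 0) (arr 0 n)).symm.trans (σ.map_id _)
  simp [reassoc_of% this]

lemma cons_map_one_zero {G : Type*} [Groupoid G] (σ : CodiscreteNat ⥤ G) {g : G}
    (k : σ.obj ⟨0⟩ ⟶ g) : (cons σ k).map (arr 1 0) = k := by
  refine (cons_map_succ_zero σ k 0).trans ?_
  rw [show σ.map (arr 0 0) = 𝟙 _ from σ.map_id _, Category.id_comp]

lemma cons_map_zero_one_comp {G : Type*} [Groupoid G] (σ : CodiscreteNat ⥤ G) {g : G}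
    (k : σ.obj ⟨0⟩ ⟶ g) : (cons σ k).map (arr 0 1) ≫ k = 𝟙 g := by
  have h := (cons σ k).map_comp (arr 0 1) (arr 1 0)
  rw [cons_map_one_zero] at h
  exact h.symm.trans ((cons σ k).map_id _)

namespace Chain

variable {X : Aᵒᵖ ⥤ Grpd.{u, u}}

lemma w_obj {p q : Chain X} (f : p ⟶ q) (n : ℕ) :
    p.pt.obj ⟨f.idx n⟩ = (res X f.hom).obj (q.pt.obj ⟨n⟩) :=
  Functor.congr_obj f.w ⟨n⟩

lemma w_map {p q : Chain X} (f : p ⟶ q) (m n : ℕ) :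
    p.pt.map (arr (f.idx m) (f.idx n)) =
      eqToHom (w_obj f m) ≫ (res X f.hom).map (q.pt.map (arr m n)) ≫ eqToHom (w_obj f n).symm :=
  Functor.congr_hom f.w (arr m n)

variable (X)

/-- Evaluation at `0`. -/
@[simps]
def eval : Chain X ⥤ GEl X where
  obj p := ⟨p.base, p.pt.obj ⟨0⟩⟩
  map {p q} f := ⟨f.hom, p.pt.map (arr 0 (f.idx 0)) ≫ eqToHom (w_obj f 0)⟩
  map_id p := GEl.hom_ext rfl ((comp_eqToHom_heq _ _).trans
    ((heq_of_eq (p.pt.map_id ⟨0⟩)).trans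
      (eqToHom_heq_eqToHom rfl (GEl.res_id_obj X (p.pt.obj ⟨0⟩)).symm rfl)))
  map_comp {p q r} f g := by
    refine GEl.hom_ext rfl (heq_of_eq ?_)
    have h : p.pt.map (arr 0 (f.idx (g.idx 0))) =
      p.pt.map (arr 0 (f.idx 0)) ≫ p.pt.map (arr (f.idx 0) (f.idx (g.idx 0))) :=
      p.pt.map_comp (arr 0 (f.idx 0)) (arr (f.idx 0) (f.idx (g.idx 0)))
    change p.pt.map (arr 0 (f.idx (g.idx 0))) ≫ _ =
      (p.pt.map (arr 0 (f.idx 0)) ≫ _) ≫ (res X f.hom).map (q.pt.map (arr 0 (g.idx 0)) ≫ _) ≫ _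
    rw [h, w_map]
    simp [eqToHom_map]

variable {X} {y : GEl X}

/-- The morphism of `A` underlying an object of a slice of `eval X`. -/
abbrev sliceHom (s : CostructuredArrow (eval X) y) : s.left.base ⟶ y.base :=
  GEl.Hom.hom (p := (eval X).obj s.left) s.hom

/-- The morphism of a fiber of `X` underlying an object of a slice of `eval X`. -/
abbrev sliceFiber (s : CostructuredArrow (eval X) y) :
    s.left.pt.obj ⟨0⟩ ⟶ (res X (sliceHom s)).obj y.pt :=
  GEl.Hom.fiber (p := (eval X).obj s.left) s.hom

/-- The chain obtained from an object of a slice of `eval X` by adding a new zeroth term. -/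
abbrev consChain (s : CostructuredArrow (eval X) y) : Chain X :=
  ⟨s.left.base, cons s.left.pt (sliceFiber s)⟩

lemma slice_w {s t : CostructuredArrow (eval X) y} (g : s ⟶ t) :
    g.left.hom ≫ sliceHom t = sliceHom s :=
  congrArg GEl.Hom.hom (CostructuredArrow.w g)

lemma slice_w_fiber {s t : CostructuredArrow (eval X) y} (g : s ⟶ t) :
    (s.left.pt.map (arr 0 (g.left.idx 0)) ≫ eqToHom (w_obj g.left 0)) ≫
      (res X g.left.hom).map (sliceFiber t) ≍ sliceFiber s := by
  have h {k l : (eval X).obj s.left ⟶ y} (e : k = l) : k.fiber ≍ l.fiber := by rw [e]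
  exact (comp_comp_eqToHom_heq _ _ _).symm.trans (h (CostructuredArrow.w g))

lemma slice_w_obj {s t : CostructuredArrow (eval X) y} (g : s ⟶ t) :
    (res X (sliceHom s)).obj y.pt = (res X g.left.hom).obj ((res X (sliceHom t)).obj y.pt) :=
  (congrArg (fun f => (res X f).obj y.pt) (slice_w g).symm).trans
    (GEl.res_comp_obj X g.left.hom (sliceHom t) y.pt)

/-- Functoriality of adding a zeroth term. By `functor_ext_succ` there are three checks: at 0 it is
the equality of underlying morphisms of `A`, on the shift it is the condition on `g`, and on the
arrow from 1 to 0 it is the fiber part of the triangle over `y`. -/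
lemma shift_cons {s t : CostructuredArrow (eval X) y} (g : s ⟶ t) :
    fn (shift g.left.idx) ⋙ cons s.left.pt (sliceFiber s) =
      cons t.left.pt (sliceFiber t) ⋙ res X g.left.hom := by
  refine functor_ext_succ (slice_w_obj g) ?_ ?_
  · refine Eq.trans ?_ (congrArg (· ⋙ res X g.left.hom) (fn_succ_cons t.left.pt _).symm)
    refine Eq.trans ?_ g.left.w
    exact congrArg (fn g.left.idx ⋙ ·) (fn_succ_cons s.left.pt (sliceFiber s))
  · refine (heq_of_eq (cons_map_succ_zero s.left.pt (sliceFiber s) (g.left.idx 0))).trans ?_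
    refine HEq.trans ?_ (heq_of_eq (congrArg (res X g.left.hom).map
      (cons_map_one_zero t.left.pt (sliceFiber t)).symm))
    exact map_comp_heq_of_heq s.left.pt (sliceFiber s) _ _ (slice_w_obj g) (slice_w_fiber g)

/-- The endofunctor of a slice of `eval X` adding a new zeroth term. -/
def consFunctor (y : GEl X) : CostructuredArrow (eval X) y ⥤ CostructuredArrow (eval X) y where
  -- The new zeroth term is the restriction of `y.pt` itself, so the fiber of the structure map
  -- becomes an identity.
  obj s := CostructuredArrow.mk (Y := consChain s)
    (show (eval X).obj (consChain s) ⟶ y from ⟨sliceHom s, 𝟙 _⟩)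
  map {s t} g := by
    refine CostructuredArrow.homMk
      (show consChain s ⟶ consChain t from ⟨shift g.left.idx, g.left.hom, shift_cons g⟩) ?_
    refine GEl.hom_ext (slice_w g) ?_
    exact (comp_map_id_comp_heq (res X g.left.hom) _ _ _).trans
      (heq_of_eq (cons_map_zero_zero s.left.pt (sliceFiber s)))
  map_id s := CostructuredArrow.hom_ext _ _ (Chain.hom_ext
    (funext fun n => by cases n <;> rfl) rfl)
  map_comp f g := CostructuredArrow.hom_ext _ _ (Chain.hom_ext
    (funext fun n => by cases n <;> rfl) rfl)

/-- Removing the new zeroth term. -/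
def consToId (y : GEl X) : consFunctor y ⟶ 𝟭 _ where
  app s := by
    refine CostructuredArrow.homMk
      (show consChain s ⟶ s.left from ⟨Nat.succ, 𝟙 _,
        (fn_succ_cons _ _).trans (congrArg (s.left.pt ⋙ ·) (res_id X s.left.base).symm)⟩) ?_
    refine GEl.hom_ext (Category.id_comp _) ?_
    -- Evaluating the successor map gives the arrow from term 0 to term 1 of the extended chain,
    -- which is inverse to the old fiber.
    exact comp_map_comp_heq_id (res_id X s.left.base) (sliceFiber s) _
      (cons_map_zero_one_comp s.left.pt (sliceFiber s)) _ _
  naturality s t g := CostructuredArrow.hom_ext _ _ (Chain.hom_ext rfl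
    ((Category.comp_id _).trans (Category.id_comp _).symm))

/-- Keeping only the new zeroth term. -/
def consToConst (y : GEl X) : consFunctor y ⟶ (Functor.const _).obj
    (CostructuredArrow.mk (Y := ⟨y.base, (Functor.const _).obj y.pt⟩)
      (show (eval X).obj ⟨y.base, (Functor.const _).obj y.pt⟩ ⟶ y from 𝟙 y)) where
  app s := by
    refine CostructuredArrow.homMk
      (show consChain s ⟶ ⟨y.base, (Functor.const _).obj y.pt⟩ from
        ⟨fun _ => 0, sliceHom s, (fn_zero_cons _ _).trans
          (CategoryTheory.Functor.hext (fun _ => rfl)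
            (fun _ _ _ => heq_of_eq ((res X (sliceHom s)).map_id y.pt).symm))⟩) ?_
    refine GEl.hom_ext (Category.comp_id _) ?_
    exact (comp_map_eqToHom_comp_heq (res X (sliceHom s)) _ (GEl.res_id_obj X y.pt).symm _ _).trans
      (heq_of_eq (cons_map_zero_zero s.left.pt (sliceFiber s)))
  naturality s t g := by
    exact CostructuredArrow.hom_ext _ _ (Chain.hom_ext rfl
      ((slice_w g).trans (Category.comp_id _).symm))

end Chain

/-- Adding a zeroth term contracts every slice of `Chain.eval X` onto the constant chain at `y`, so
asphericity of `Chain X` passes to its target. -/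
lemma isAspherical_gel {W : MorphismProperty Cat.{u, u}} (hW : IsBasicLocalizer W)
    (X : Aᵒᵖ ⥤ Grpd.{u, u}) (h : IsAspherical W (El (chains X))) : IsAspherical W (GEl X) :=
  hW.isAspherical_of_mem' (hW.of_isAspherical_slices (Chain.eval X) fun y =>
    hW.isAspherical_of_contraction (Chain.consFunctor y) (Chain.consToId y) _
      (Chain.consToConst y)) (Chain.isAspherical X hW h)

/-- Needed for `Core.functorToCore`: a functor out of a groupoid takes values in isomorphisms, hence
factors through the core. -/
instance : Groupoid CodiscreteNat where
  inv _ := ()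

/-- The chains of `I_A^*(C)` form the presheaf `i_A^*(C^J)`. -/
def chainsGelNerveIso (C : Type u) [SmallCategory C] :
    chains ((gelNerve A).obj (Cat.of C)) ≅ (elNerve A).obj (Cat.of (CodiscreteNat ⥤ C)) :=
  -- Exchange of the two variables; restricting to the core of the functor category loses nothing
  -- because the source is a groupoid.
  NatIso.ofComponents (fun a => Equiv.toIso
    { toFun σ := Functor.toCatHom (Functor.flip
        ((show CodiscreteNat ⥤ Core (Over a.unop ⥤ C) from σ) ⋙ Core.inclusion _))
      invFun p := Core.functorToCore (Functor.flip
        (show Over a.unop ⥤ CodiscreteNat ⥤ C from Cat.Hom.toFunctor p))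
      left_inv σ := CategoryTheory.Functor.hext (fun _ => rfl)
        (fun _ _ _ => heq_of_eq (Core.hom_ext rfl))
      right_inv p := rfl })

/-- The functor category from the contractible groupoid to `C` inherits a terminal object, so the
weak test property applies to it and gives the asphericity required by `isAspherical_gel`. -/
lemma isGroupoidalWeakTest_of_isWeakTest {W : MorphismProperty Cat.{u, u}}
    (hW : IsBasicLocalizer W) (h : IsWeakTest W A) : IsGroupoidalWeakTest W A := by
  refine isGroupoidalWeakTest_of_isAspherical hW fun C _ _ => isAspherical_gel hW _ ?_
  exact hW.isAspherical_of_mem (F := El.map (chainsGelNerveIso C).hom)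
    (hW.weaklySaturated.isomorphisms_le _
      (inferInstanceAs (IsIso ((elFunctor A).map (chainsGelNerveIso C).hom))))
    (h.isAspherical hW (CodiscreteNat ⥤ C))

end

end TestCat

theorem mainTheorem2 (W : MorphismProperty Cat.{u, u}) (hW : TestCat.IsBasicLocalizer W)
    (A : Type u) [SmallCategory A] :
    (TestCat.IsWeakTest W A → TestCat.IsGroupoidalWeakTest W A) ∧
    (TestCat.HasNoNontrivialIso A →
      TestCat.IsGroupoidalWeakTest W A → TestCat.IsWeakTest W A) :=
  ⟨TestCat.isGroupoidalWeakTest_of_isWeakTest hW,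
    TestCat.isWeakTest_of_isGroupoidalWeakTest hW⟩
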